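/- Let $I=[0,1]$ and let $PL_o(I)$ be the group, under composition, of orientation-preserving piecewise linear homeomorphisms of $I$ with finitely many breakpoints. A group is called locally solvable if each of its finitely generated subgroups is solvable. Then every locally solvable subgroup of $PL_o(I)$ is countable. -/

import Mathlib

/-- A self-map `f` of the unit interval `[0,1]` is piecewise linear with finitely many breakpoints:
there is a finite set `B` of points such that `f` is affine on every closed subinterval `[x, y]`
whose interior contains no point of `B`. -/
def IsPiecewiseLinear (f : unitInterval → unitInterval) : Prop :=
  ∃ B : Set unitInterval, B.Finite ∧ ∀ x y : unitInterval, Disjoint (Set.Ioo x y) B →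
    ∃ a b : ℝ, ∀ z ∈ Set.Icc x y, (f z : ℝ) = a * (z : ℝ) + b

/-- The group `PL_o(I)` of orientation-preserving piecewise linear homeomorphisms of the unit
interval with finitely many breakpoints, as a subgroup of the group of all self-homeomorphisms
of the unit interval under composition. -/
def PLo : Subgroup (unitInterval ≃ₜ unitInterval) where
  carrier := {f | StrictMono f ∧ IsPiecewiseLinear f}
  one_mem' := ⟨fun _ _ h => h, ∅, Set.finite_empty, fun _ _ _ => ⟨1, 0, fun z _ => by simp⟩⟩
  mul_mem' := by
    rintro f g ⟨hf, B, hB, hfB⟩ ⟨hg, C, hC, hgC⟩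
    refine ⟨hf.comp hg, C ∪ g ⁻¹' B, hC.union (hB.preimage g.injective.injOn), ?_⟩
    intro x y hxy
    rw [Set.disjoint_union_right] at hxy
    obtain ⟨a, b, hab⟩ := hgC x y hxy.1
    have hd : Disjoint (Set.Ioo (g x) (g y)) B := by
      rw [Set.disjoint_left]
      intro w hw hwB
      obtain ⟨z, rfl⟩ := g.surjective w
      exact Set.disjoint_left.1 hxy.2 ⟨hg.lt_iff_lt.1 hw.1, hg.lt_iff_lt.1 hw.2⟩ hwB
    obtain ⟨c, d, hcd⟩ := hfB _ _ hd
    refine ⟨c * a, c * b + d, fun z hz => ?_⟩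
    have h1 := hcd (g z) ⟨hg.monotone hz.1, hg.monotone hz.2⟩
    rw [hab z hz] at h1
    change ((f (g z) : unitInterval) : ℝ) = _
    rw [h1]
    ring
  inv_mem' := by
    rintro f ⟨hf, B, hB, hfB⟩
    have hi : StrictMono f.symm := fun u v huv => by
      rw [← hf.lt_iff_lt]
      simpa using huv
    refine ⟨hi, f '' B, hB.image f, ?_⟩
    intro x y hxy
    change ∃ a b : ℝ, ∀ z ∈ Set.Icc x y, (f.symm z : ℝ) = a * (z : ℝ) + b
    have hd : Disjoint (Set.Ioo (f.symm x) (f.symm y)) B := by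
      rw [Set.disjoint_left]
      intro w hw hwB
      refine Set.disjoint_left.1 hxy ⟨?_, ?_⟩ ⟨w, hwB, rfl⟩
      · simpa using hf hw.1
      · simpa using hf hw.2
    obtain ⟨a, b, hab⟩ := hfB _ _ hd
    by_cases ha : a = 0
    · refine ⟨0, (f.symm x : ℝ), fun z hz => ?_⟩
      have hzx := hab (f.symm z) ⟨hi.monotone hz.1, hi.monotone hz.2⟩
      have hxx := hab (f.symm x) ⟨le_rfl, hi.monotone (hz.1.trans hz.2)⟩
      simp only [Homeomorph.apply_symm_apply, ha, zero_mul, zero_add] at hzx hxx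
      have : z = x := Subtype.ext (hzx.trans hxx.symm)
      simp [this]
    · refine ⟨a⁻¹, -(a⁻¹ * b), fun z hz => ?_⟩
      have hzx := hab (f.symm z) ⟨hi.monotone hz.1, hi.monotone hz.2⟩
      rw [Homeomorph.apply_symm_apply] at hzx
      rw [hzx]
      field_simp
      ring

/-- A group is locally solvable if every finitely generated subgroup is solvable. -/
def IsLocallySolvable (G : Type*) [Group G] : Prop :=
  ∀ H : Subgroup G, H.FG → Group.IsSolvable H

/-!
Let `PL_o(I)` act on the line by extending its elements by the identity outside `I`. An *orbital*
of an element is a maximal open interval of points that it moves.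

A locally solvable group `Γ` has a laminar family of orbitals: an orbital `(a, b)` of `f` and an
orbital `(c, d)` of `g` never satisfy `a < c < b < d` (`not_isSolvable_of_transition`). If they
did, let `Q = ⟨f, g⟩`, and consider the gap `(z, y)` around `c` in the set of points fixed by the
derived group `Q'`. The group `Q` fixes `z` and `y`. Piecewise linear germs at a fixed point
commute, so elements of `Q'` are supported, within `(z, y)`, in compact subsets, while `Q'` has no
fixed point there and so displaces every compact subset. Hence `⁅u, v⁆ = ⁅⁅u, h⁆, ⁅v, k⁆⁆` on
`(z, y)` for suitable `h`, `k` in `Q'`, which puts `⁅u, v⁆` into every term of the derived series up to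
elements trivial on `(z, y)`. If `Q` were solvable, `Q'` would thus be abelian on `(z, y)`; but an
element displacing the support of `u` does not commute with `u`.

Laminarity has two countability consequences for `Γ`. The set `E` of left ends of orbitals is
countable (`IsLaminarPLGroup.countable_left_ends`), because an element moves each orbital strictly
inside one of its own off itself, which leaves gaps in chains of orbitals. And for every point
`e`, the slopes at `e` on the right of the elements fixing `e` form a countable set
(`IsLaminarPLGroup.countable_right_slopes`).

Two distinct elements of `Γ` first differ to the right of some `c ∈ E`, where one of them has a
breakpoint (`IsLaminarPLGroup.exists_first_difference`). So among the elements whose breakpoints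
in `E` form a given finite set, pairwise first differences lie in this finite set, and by
induction on it there are only countably many of them; and `E` has only countably many finite
subsets.
-/

open Set Filter Topology
open scoped commutatorElement

/-! ### Piecewise linear self-maps of the line and their germs -/

/-- A function `ℝ → ℝ` is piecewise linear with finitely many breakpoints: it is affine on every
closed interval whose interior avoids some fixed finite set. -/
def IsPLFun (g : ℝ → ℝ) : Prop :=
  ∃ B : Set ℝ, B.Finite ∧ ∀ x y : ℝ, Disjoint (Ioo x y) B →
    ∃ a b : ℝ, ∀ z ∈ Icc x y, g z = a * z + b

theorem IsPLFun.exists_right {g : ℝ → ℝ} (hg : IsPLFun g) (x : ℝ) :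
    ∃ s : ℝ, ∃ y > x, ∀ z ∈ Icc x y, g z = g x + s * (z - x) := by
  obtain ⟨B, hB, h⟩ := hg
  have h1 : (B \ {x})ᶜ ∈ 𝓝[>] x :=
    mem_nhdsWithin_of_mem_nhds ((hB.subset sdiff_subset).isClosed.isOpen_compl.mem_nhds (by simp))
  obtain ⟨y, hy, hxy⟩ := mem_nhdsGT_iff_exists_Ioo_subset.1 h1
  obtain ⟨a, b, hab⟩ := h x y (by
    rw [Set.disjoint_left]
    intro z hz hzB
    exact hxy hz ⟨hzB, hz.1.ne'⟩)
  refine ⟨a, y, hy, fun z hz => ?_⟩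
  rw [hab z hz, hab x ⟨le_rfl, le_of_lt hy⟩]
  ring

theorem IsPLFun.exists_left {g : ℝ → ℝ} (hg : IsPLFun g) (x : ℝ) :
    ∃ s : ℝ, ∃ y < x, ∀ z ∈ Icc y x, g z = g x + s * (z - x) := by
  obtain ⟨B, hB, h⟩ := hg
  have h1 : (B \ {x})ᶜ ∈ 𝓝[<] x :=
    mem_nhdsWithin_of_mem_nhds ((hB.subset sdiff_subset).isClosed.isOpen_compl.mem_nhds (by simp))
  obtain ⟨y, hy, hxy⟩ := mem_nhdsLT_iff_exists_Ioo_subset.1 h1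
  obtain ⟨a, b, hab⟩ := h y x (by
    rw [Set.disjoint_left]
    intro z hz hzB
    exact hxy hz ⟨hzB, hz.2.ne⟩)
  refine ⟨a, y, hy, fun z hz => ?_⟩
  rw [hab z hz, hab x ⟨le_of_lt hy, le_rfl⟩]
  ring

theorem IsPLFun.eventually_right {g : ℝ → ℝ} (hg : IsPLFun g) (x : ℝ) :
    ∃ s : ℝ, ∀ᶠ z in 𝓝[>] x, g z = g x + s * (z - x) := by
  obtain ⟨s, y, hy, h⟩ := hg.exists_right x
  refine ⟨s, ?_⟩
  filter_upwards [Ioo_mem_nhdsGT hy] with z hz using h z ⟨hz.1.le, hz.2.le⟩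

theorem IsPLFun.eventually_left {g : ℝ → ℝ} (hg : IsPLFun g) (x : ℝ) :
    ∃ s : ℝ, ∀ᶠ z in 𝓝[<] x, g z = g x + s * (z - x) := by
  obtain ⟨s, y, hy, h⟩ := hg.exists_left x
  refine ⟨s, ?_⟩
  filter_upwards [Ioo_mem_nhdsLT hy] with z hz using h z ⟨hz.1.le, hz.2.le⟩

theorem OrderIso.tendsto_nhdsGT (g : ℝ ≃o ℝ) (x : ℝ) : Tendsto g (𝓝[>] x) (𝓝[>] (g x)) :=
  tendsto_nhdsWithin_of_tendsto_nhds_of_eventually_within _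
    (g.continuous.continuousAt.tendsto.mono_left nhdsWithin_le_nhds)
    (eventually_nhdsWithin_of_forall fun _ hz => g.strictMono hz)

theorem OrderIso.tendsto_nhdsLT (g : ℝ ≃o ℝ) (x : ℝ) : Tendsto g (𝓝[<] x) (𝓝[<] (g x)) :=
  tendsto_nhdsWithin_of_tendsto_nhds_of_eventually_within _
    (g.continuous.continuousAt.tendsto.mono_left nhdsWithin_le_nhds)
    (eventually_nhdsWithin_of_forall fun _ hz => g.strictMono hz)

theorem eventually_commute_of_linear {g h : ℝ → ℝ} {l : Filter ℝ} {z s t : ℝ}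
    (hgl : Tendsto g l l) (hhl : Tendsto h l l) (hg : ∀ᶠ x in l, g x = z + s * (x - z))
    (hh : ∀ᶠ x in l, h x = z + t * (x - z)) : ∀ᶠ x in l, g (h x) = h (g x) := by
  filter_upwards [hg, hh, hgl.eventually hh, hhl.eventually hg] with x h1 h2 h3 h4
  rw [h4, h3, h1, h2]
  ring

/-- The germs at a common fixed point are linear, hence commute. -/
theorem eventually_commutator_right {g h : ℝ ≃o ℝ} {z : ℝ} (hg : IsPLFun ⇑g⁻¹)
    (hh : IsPLFun ⇑h⁻¹) (hgz : g z = z) (hhz : h z = z) : ∀ᶠ x in 𝓝[>] z, ⁅g, h⁆ x = x := by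
  have hgz' : g⁻¹ z = z := by conv_lhs => rw [← hgz, RelIso.inv_apply_self]
  have hhz' : h⁻¹ z = z := by conv_lhs => rw [← hhz, RelIso.inv_apply_self]
  obtain ⟨s, hs⟩ := hg.eventually_right z
  obtain ⟨t, ht⟩ := hh.eventually_right z
  have h1 := g⁻¹.tendsto_nhdsGT z
  have h2 := h⁻¹.tendsto_nhdsGT z
  rw [hgz'] at h1 hs
  rw [hhz'] at h2 ht
  filter_upwards [eventually_commute_of_linear h1 h2 hs ht] with x hx
  change g (h (g⁻¹ (h⁻¹ x))) = x
  rw [hx, RelIso.apply_inv_self, RelIso.apply_inv_self]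

theorem eventually_commutator_left {g h : ℝ ≃o ℝ} {z : ℝ} (hg : IsPLFun ⇑g⁻¹)
    (hh : IsPLFun ⇑h⁻¹) (hgz : g z = z) (hhz : h z = z) : ∀ᶠ x in 𝓝[<] z, ⁅g, h⁆ x = x := by
  have hgz' : g⁻¹ z = z := by conv_lhs => rw [← hgz, RelIso.inv_apply_self]
  have hhz' : h⁻¹ z = z := by conv_lhs => rw [← hhz, RelIso.inv_apply_self]
  obtain ⟨s, hs⟩ := hg.eventually_left z
  obtain ⟨t, ht⟩ := hh.eventually_left z
  have h1 := g⁻¹.tendsto_nhdsLT z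
  have h2 := h⁻¹.tendsto_nhdsLT z
  rw [hgz'] at h1 hs
  rw [hhz'] at h2 ht
  filter_upwards [eventually_commute_of_linear h1 h2 hs ht] with x hx
  change g (h (g⁻¹ (h⁻¹ x))) = x
  rw [hx, RelIso.apply_inv_self, RelIso.apply_inv_self]

/-! ### Fixed points and orbitals -/

theorem inv_apply_eq_self {g : ℝ ≃o ℝ} {x : ℝ} (h : g x = x) : g⁻¹ x = x := by
  conv_lhs => rw [← h, RelIso.inv_apply_self]

theorem inv_apply_ne_self {g : ℝ ≃o ℝ} {x : ℝ} (h : g x ≠ x) : g⁻¹ x ≠ x := fun h' =>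
  h (by simpa using inv_apply_eq_self h')

/-- The subgroup of order automorphisms of the line fixing `x`. -/
def fixer (x : ℝ) : Subgroup (ℝ ≃o ℝ) where
  carrier := {g | g x = x}
  one_mem' := rfl
  mul_mem' := fun {g h} (hg : g x = x) (hh : h x = x) => by
    change g (h x) = x
    rw [hh, hg]
  inv_mem' := fun h => inv_apply_eq_self h

theorem mem_fixer {x : ℝ} {g : ℝ ≃o ℝ} : g ∈ fixer x ↔ g x = x := Iff.rfl

/-- The subgroup of order automorphisms of the line which are the identity along the filter `l`. -/
def germFixer (l : Filter ℝ) : Subgroup (ℝ ≃o ℝ) where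
  carrier := {g | ∀ᶠ x in l, g x = x}
  one_mem' := Eventually.of_forall fun _ => rfl
  mul_mem' := fun {g h} (hg : ∀ᶠ x in l, g x = x) (hh : ∀ᶠ x in l, h x = x) => by
    change ∀ᶠ x in l, g (h x) = x
    filter_upwards [hg, hh] with x h1 h2
    rw [h2, h1]
  inv_mem' := fun {g} (hg : ∀ᶠ x in l, g x = x) => by
    change ∀ᶠ x in l, g⁻¹ x = x
    filter_upwards [hg] with x h1 using inv_apply_eq_self h1

theorem mem_germFixer {l : Filter ℝ} {g : ℝ ≃o ℝ} : g ∈ germFixer l ↔ ∀ᶠ x in l, g x = x := Iff.rfl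

theorem apply_sSup_eq {u : ℝ ≃o ℝ} {S : Set ℝ} (hne : S.Nonempty) (hb : BddAbove S)
    (hu : u '' S = S) : u (sSup S) = sSup S := by
  rw [u.map_csSup' hne hb, hu]

theorem apply_sInf_eq {u : ℝ ≃o ℝ} {S : Set ℝ} (hne : S.Nonempty) (hb : BddBelow S)
    (hu : u '' S = S) : u (sInf S) = sInf S := by
  rw [u.map_csInf' hne hb, hu]

theorem image_eq_self_of_fixed {u : ℝ ≃o ℝ} {S : Set ℝ} (h : ∀ x ∈ S, u x = x) : u '' S = S := by
  rw [Set.image_congr h, Set.image_id']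

theorem image_orbit_eq {Γ : Subgroup (ℝ ≃o ℝ)} {u : ℝ ≃o ℝ} (hu : u ∈ Γ) (p : ℝ) :
    u '' {x | ∃ h ∈ Γ, h p = x} = {x | ∃ h ∈ Γ, h p = x} := by
  apply Set.Subset.antisymm
  · rintro _ ⟨_, ⟨h, hh, rfl⟩, rfl⟩
    exact ⟨u * h, Γ.mul_mem hu hh, rfl⟩
  · rintro _ ⟨h, hh, rfl⟩
    exact ⟨u⁻¹ (h p), ⟨u⁻¹ * h, Γ.mul_mem (Γ.inv_mem hu) hh, rfl⟩, by simp⟩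

/-- The supremum of an orbit is a fixed point; so between two consecutive fixed points a group moves
every point arbitrarily far to the right. -/
theorem exists_lt_apply {Γ : Subgroup (ℝ ≃o ℝ)} {z y : ℝ}
    (hno : ∀ x ∈ Ioo z y, ∃ h ∈ Γ, h x ≠ x) {p q : ℝ} (hp : p ∈ Ioo z y) (hq : q ∈ Ioo z y) :
    ∃ h ∈ Γ, q < h p := by
  by_contra! hcon
  set S : Set ℝ := {x | ∃ h ∈ Γ, h p = x} with hS
  have hpS : p ∈ S := ⟨1, Γ.one_mem, rfl⟩
  have hub : ∀ x ∈ S, x ≤ q := by rintro _ ⟨h, hh, rfl⟩; exact hcon h hh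
  have hbdd : BddAbove S := ⟨q, hub⟩
  obtain ⟨h, hh, hne⟩ := hno (sSup S)
    ⟨hp.1.trans_le (le_csSup hbdd hpS), (csSup_le ⟨p, hpS⟩ hub).trans_lt hq.2⟩
  exact hne (apply_sSup_eq ⟨p, hpS⟩ hbdd (image_orbit_eq hh p))

/-- `(a, b)` is an orbital of `g`: a maximal open interval moved by `g`. -/
structure IsOrbital (g : ℝ ≃o ℝ) (a b : ℝ) : Prop where
  lt : a < b
  left : g a = a
  right : g b = b
  ne : ∀ x ∈ Ioo a b, g x ≠ x

namespace IsOrbital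

variable {g f : ℝ ≃o ℝ} {a b : ℝ}

theorem inv (h : IsOrbital g a b) : IsOrbital g⁻¹ a b :=
  ⟨h.lt, inv_apply_eq_self h.left, inv_apply_eq_self h.right, fun x hx =>
    inv_apply_ne_self (h.ne x hx)⟩

theorem apply_mem (h : IsOrbital g a b) {x : ℝ} (hx : x ∈ Ioo a b) : g x ∈ Ioo a b := by
  constructor
  · rw [← h.left]; exact g.strictMono hx.1
  · rw [← h.right]; exact g.strictMono hx.2

theorem conj (h : IsOrbital g a b) (f : ℝ ≃o ℝ) : IsOrbital (f * g * f⁻¹) (f a) (f b) := by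
  refine ⟨f.strictMono h.lt, ?_, ?_, fun x hx hfix => ?_⟩
  · simp [RelIso.mul_apply, h.left]
  · simp [RelIso.mul_apply, h.right]
  · have h1 : f⁻¹ x ∈ Ioo a b := by
      constructor
      · rw [← f.lt_iff_lt]; simpa using hx.1
      · rw [← f.lt_iff_lt]; simpa using hx.2
    refine h.ne _ h1 ?_
    have h2 : f (g (f⁻¹ x)) = x := hfix
    apply f.injective
    rw [h2, RelIso.apply_inv_self]

theorem exists_lt_zpow (h : IsOrbital g a b) {p q : ℝ} (hp : p ∈ Ioo a b) (hq : q ∈ Ioo a b) :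
    ∃ n : ℤ, q < (g ^ n) p := by
  obtain ⟨_, ⟨n, rfl⟩, hn⟩ := exists_lt_apply (Γ := Subgroup.zpowers g)
    (fun x hx => ⟨g, Subgroup.mem_zpowers g, h.ne x hx⟩) hp hq
  exact ⟨n, hn⟩

theorem zpow_apply_left (h : IsOrbital g a b) (n : ℤ) : (g ^ n) a = a :=
  (fixer a).zpow_mem h.left n

theorem zpow_apply_right (h : IsOrbital g a b) (n : ℤ) : (g ^ n) b = b :=
  (fixer b).zpow_mem h.right n

theorem zpow_apply_mem (h : IsOrbital g a b) (n : ℤ) {x : ℝ} (hx : x ∈ Ioo a b) :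
    (g ^ n) x ∈ Ioo a b := by
  constructor
  · rw [← h.zpow_apply_left n]; exact (g ^ n).strictMono hx.1
  · rw [← h.zpow_apply_right n]; exact (g ^ n).strictMono hx.2

theorem exists_zpow_lt (h : IsOrbital g a b) {p q : ℝ} (hp : p ∈ Ioo a b) (hq : q ∈ Ioo a b) :
    ∃ n : ℤ, (g ^ n) p < q := by
  obtain ⟨n, hn⟩ := h.exists_lt_zpow hq hp
  refine ⟨-n, ?_⟩
  rw [← (g ^ n).lt_iff_lt, zpow_neg, RelIso.apply_inv_self]
  exact hn

theorem lt_of_lt (h : IsOrbital g a b) {x y : ℝ} (hx : x ∈ Ioo a b) (hy : y ∈ Ioo a b)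
    (hlt : g x < x) : g y < y := by
  by_contra! hle
  obtain ⟨w, hw, hw'⟩ := isPreconnected_Ioo.intermediate_value₂ hx hy
    g.continuous.continuousOn continuousOn_id hlt.le hle
  exact h.ne w hw hw'

/-- The right end of an orbital of `g` is the supremum of the `g`-orbit of any point in it, so it is
fixed by every `u` that fixes this orbit pointwise. -/
theorem fixed_right {u : ℝ ≃o ℝ} (h : IsOrbital g a b) {x : ℝ} (hx : x ∈ Ioo a b)
    (hu : ∀ n : ℤ, u ((g ^ n) x) = (g ^ n) x) : u b = b := by
  have hne : (Set.range fun n : ℤ => (g ^ n) x).Nonempty := Set.range_nonempty _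
  have hub : ∀ y ∈ Set.range fun n : ℤ => (g ^ n) x, y ≤ b := by
    rintro _ ⟨n, rfl⟩; exact (h.zpow_apply_mem n hx).2.le
  have hs : sSup (Set.range fun n : ℤ => (g ^ n) x) = b := by
    refine le_antisymm (csSup_le hne hub) (le_of_forall_lt_imp_le_of_dense fun q hq => ?_)
    obtain ⟨n, hn⟩ := h.exists_lt_zpow hx (q := max q x) ⟨hx.1.trans_le (le_max_right _ _),
      max_lt hq hx.2⟩
    exact ((le_max_left _ _).trans hn.le).trans (le_csSup ⟨b, hub⟩ ⟨n, rfl⟩)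
  have := apply_sSup_eq (u := u) hne ⟨b, hub⟩
    (image_eq_self_of_fixed (by rintro _ ⟨n, rfl⟩; exact hu n))
  rwa [hs] at this

theorem fixed_left {u : ℝ ≃o ℝ} (h : IsOrbital g a b) {x : ℝ} (hx : x ∈ Ioo a b)
    (hu : ∀ n : ℤ, u ((g ^ n) x) = (g ^ n) x) : u a = a := by
  have hne : (Set.range fun n : ℤ => (g ^ n) x).Nonempty := Set.range_nonempty _
  have hlb : ∀ y ∈ Set.range fun n : ℤ => (g ^ n) x, a ≤ y := by
    rintro _ ⟨n, rfl⟩; exact (h.zpow_apply_mem n hx).1.le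
  have hs : sInf (Set.range fun n : ℤ => (g ^ n) x) = a := by
    refine le_antisymm (le_of_forall_gt_imp_ge_of_dense fun q hq => ?_) (le_csInf hne hlb)
    obtain ⟨n, hn⟩ := h.exists_zpow_lt hx (q := min q x) ⟨lt_min hq hx.1,
      (min_le_right _ _).trans_lt hx.2⟩
    exact (csInf_le ⟨a, hlb⟩ ⟨n, rfl⟩).trans (hn.le.trans (min_le_left _ _))
  have := apply_sInf_eq (u := u) hne ⟨a, hlb⟩
    (image_eq_self_of_fixed (by rintro _ ⟨n, rfl⟩; exact hu n))
  rwa [hs] at this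

end IsOrbital

/-- A moved point with fixed points on either side lies in an orbital. -/
theorem exists_isOrbital {g : ℝ ≃o ℝ} {p x y : ℝ} (hp : g p ≠ p) (hx : g x = x) (hxp : x ≤ p)
    (hy : g y = y) (hpy : p ≤ y) :
    ∃ a b, IsOrbital g a b ∧ p ∈ Ioo a b ∧ x ≤ a ∧ b ≤ y := by
  have hA : IsClosed {t | g t = t} := isClosed_eq g.continuous continuous_id
  have hA1 : BddAbove ({t | g t = t} ∩ Iic p) := ⟨p, fun t ht => ht.2⟩
  have hA2 : BddBelow ({t | g t = t} ∩ Ici p) := ⟨p, fun t ht => ht.2⟩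
  have ha := (hA.inter isClosed_Iic).csSup_mem ⟨x, hx, hxp⟩ hA1
  have hb := (hA.inter isClosed_Ici).csInf_mem ⟨y, hy, hpy⟩ hA2
  have hap : sSup ({t | g t = t} ∩ Iic p) < p := lt_of_le_of_ne ha.2 fun h => hp (by
    have h1 : g _ = _ := ha.1
    rwa [h] at h1)
  have hpb : p < sInf ({t | g t = t} ∩ Ici p) := lt_of_le_of_ne hb.2 fun h => hp (by
    have h1 : g _ = _ := hb.1
    rwa [← h] at h1)
  refine ⟨_, _, ⟨hap.trans hpb, ha.1, hb.1, fun t ht htfix => ?_⟩, ⟨hap, hpb⟩,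
    le_csSup hA1 ⟨hx, hxp⟩, csInf_le hA2 ⟨hy, hpy⟩⟩
  rcases le_total t p with h | h
  · exact ht.1.not_ge (le_csSup hA1 ⟨htfix, h⟩)
  · exact ht.2.not_ge (csInf_le hA2 ⟨htfix, h⟩)

/-! ### Solvable groups have no transition chains -/

theorem commutator_mul_mul_eq {P : Type*} [Group P] {u v u' v' : P} (h1 : Commute u' v)
    (h2 : Commute u' v') (h3 : Commute v' u) : ⁅u * u', v * v'⁆ = ⁅u, v⁆ := by
  have h4 : u' * (v * v') = v * v' * u' := (h1.mul_right h2).eq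
  have h5 : v' * u⁻¹ = u⁻¹ * v' := h3.inv_right.eq
  calc ⁅u * u', v * v'⁆ = u * (u' * (v * v')) * u'⁻¹ * u⁻¹ * v'⁻¹ * v⁻¹ := by
        simp only [commutatorElement_def]; group
    _ = u * v * (v' * u⁻¹) * v'⁻¹ * v⁻¹ := by rw [h4]; group
    _ = ⁅u, v⁆ := by rw [h5, commutatorElement_def]; group

/-- Elements displaced by their own kind have commutators lying, modulo the kernel of `ρ`, in every
term of the derived series: `⁅u, v⁆ = ⁅⁅u, h⁆, ⁅v, k⁆⁆` as soon as `h` and `k` move the supports of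
`u` and `v` away from each other. -/
theorem exists_mem_derivedSeries_map_eq {Q P : Type*} [Group Q] [Group P] (ρ : Q →* P) (D : Set Q)
    (hD : ∀ u ∈ D, ∀ v ∈ D, ∃ h ∈ D, ∃ k ∈ D, Commute (ρ (h * u⁻¹ * h⁻¹)) (ρ v) ∧
      Commute (ρ (h * u⁻¹ * h⁻¹)) (ρ (k * v⁻¹ * k⁻¹)) ∧ Commute (ρ (k * v⁻¹ * k⁻¹)) (ρ u))
    (n : ℕ) : ∀ u ∈ D, ∀ v ∈ D, ∃ w ∈ derivedSeries Q n, ρ w = ⁅ρ u, ρ v⁆ := by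
  induction n with
  | zero => exact fun u _ v _ => ⟨⁅u, v⁆, trivial, map_commutatorElement ρ u v⟩
  | succ n ih =>
    intro u hu v hv
    obtain ⟨h, hh, k, hk, h1, h2, h3⟩ := hD u hu v hv
    obtain ⟨w₁, hw₁, hρ₁⟩ := ih u hu h hh
    obtain ⟨w₂, hw₂, hρ₂⟩ := ih v hv k hk
    refine ⟨⁅w₁, w₂⁆, ?_, ?_⟩
    · rw [derivedSeries_succ]
      exact Subgroup.commutator_mem_commutator hw₁ hw₂
    · rw [map_commutatorElement, hρ₁, hρ₂, ← commutator_mul_mul_eq h1 h2 h3]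
      simp only [commutatorElement_def, map_mul, map_inv, mul_assoc]

/-- The action on the interval `(z, y)` of a group of automorphisms of the line fixing both ends. -/
def restrictIoo {Q : Type*} [Group Q] (α : Q →* (ℝ ≃o ℝ)) {z y : ℝ} (hz : ∀ q, α q z = z)
    (hy : ∀ q, α q y = y) : Q →* Equiv.Perm (Ioo z y) where
  toFun q := Equiv.Perm.subtypePerm (p := fun x => x ∈ Ioo z y) (α q).toEquiv fun x => by
    have h1 : z < α q x ↔ z < x := by conv_lhs => rw [← hz q, (α q).lt_iff_lt]
    have h2 : α q x < y ↔ x < y := by conv_lhs => rw [← hy q, (α q).lt_iff_lt]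
    exact and_congr h1 h2
  map_one' := by
    ext x
    simp
  map_mul' p q := by
    ext x
    change α (p * q) x = α p (α q x)
    rw [map_mul]
    rfl

/-- If `Q` fixes `z < y` and its derived group has no fixed point in between, then `Q` is not
solvable: linear germs commute, so the derived group acts on `(z, y)` with compact supports, and it
displaces these supports. -/
theorem not_isSolvable_of_commutator_moves {Q : Type*} [Group Q] (α : Q →* (ℝ ≃o ℝ))
    (hPL : ∀ q, IsPLFun (α q)) {z y : ℝ} (hzy : z < y) (hz : ∀ q, α q z = z) (hy : ∀ q, α q y = y)
    (hno : ∀ x ∈ Ioo z y, ∃ u ∈ commutator Q, α u x ≠ x) : ¬ Group.IsSolvable Q := by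
  intro hsolv
  set ρ := restrictIoo α hz hy
  have hmem : ∀ q : Q, ∀ x ∈ Ioo z y, α q x ∈ Ioo z y := fun q x hx =>
    (restrictIoo α hz hy q ⟨x, hx⟩).2
  have hdisp : ∀ p ∈ Ioo z y, ∀ q ∈ Ioo z y, ∃ h ∈ commutator Q, q < α h p := by
    intro p hp q hq
    obtain ⟨_, ⟨h, hh, rfl⟩, hlt⟩ := exists_lt_apply (Γ := (commutator Q).map α) (z := z) (y := y)
      (fun x hx => by
        obtain ⟨u, hu, hne⟩ := hno x hx
        exact ⟨α u, ⟨u, hu, rfl⟩, hne⟩) hp hq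
    exact ⟨h, hh, hlt⟩
  have hPLinv : ∀ q, IsPLFun ⇑(α q)⁻¹ := fun q => by rw [← map_inv]; exact hPL _
  have hgerm : ∀ l : Filter ℝ, (∀ q r, ∀ᶠ x in l, ⁅α q, α r⁆ x = x) →
      ∀ u ∈ commutator Q, ∀ᶠ x in l, α u x = x := by
    intro l hl u hu
    have hle : commutator Q ≤ (germFixer l).comap α := by
      rw [commutator_def, Subgroup.commutator_le]
      intro q _ r _
      rw [Subgroup.mem_comap, map_commutatorElement]
      exact hl q r
    exact hle hu
  have hsupp : ∀ u ∈ commutator Q, ∃ p ∈ Ioo z y, ∃ q ∈ Ioo z y,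
      ∀ x ∈ Ioo z y, α u x ≠ x → p ≤ x ∧ x ≤ q := by
    intro u hu
    have h1 := hgerm (𝓝[>] z) (fun q r => eventually_commutator_right (hPLinv q) (hPLinv r)
      (hz q) (hz r)) u hu
    have h2 := hgerm (𝓝[<] y) (fun q r => eventually_commutator_left (hPLinv q) (hPLinv r)
      (hy q) (hy r)) u hu
    obtain ⟨p, hp, hp'⟩ := (mem_nhdsGT_iff_exists_Ioo_subset' hzy).1 (h1.and (Ioo_mem_nhdsGT hzy))
    obtain ⟨q, hq, hq'⟩ := (mem_nhdsLT_iff_exists_Ioo_subset' hzy).1 (h2.and (Ioo_mem_nhdsLT hzy))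
    have hzy2 : (z + y) / 2 ∈ Ioo z y := ⟨by linarith, by linarith⟩
    refine ⟨min p ((z + y) / 2), ⟨lt_min hp hzy2.1, (min_le_right _ _).trans_lt hzy2.2⟩,
      max q ((z + y) / 2), ⟨hzy2.1.trans_le (le_max_right _ _), max_lt hq hzy2.2⟩, ?_⟩
    intro x hx hne
    constructor
    · by_contra! hlt
      exact hne (hp' ⟨hx.1, hlt.trans_le (min_le_left _ _)⟩).1
    · by_contra! hlt
      exact hne (hq' ⟨(le_max_left _ _).trans_lt hlt, hx.2⟩).1
  have hsupp2 : ∀ u ∈ commutator Q, ∀ v ∈ commutator Q, ∃ p ∈ Ioo z y, ∃ q ∈ Ioo z y,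
      ∀ x ∈ Ioo z y, (α u x ≠ x → p ≤ x ∧ x ≤ q) ∧ (α v x ≠ x → p ≤ x ∧ x ≤ q) := by
    intro u hu v hv
    obtain ⟨p, hp, q, hq, h⟩ := hsupp u hu
    obtain ⟨p', hp', q', hq', h'⟩ := hsupp v hv
    exact ⟨min p p', ⟨lt_min hp.1 hp'.1, (min_le_left _ _).trans_lt hp.2⟩, max q q',
      ⟨hq.1.trans_le (le_max_left _ _), max_lt hq.2 hq'.2⟩, fun x hx =>
      ⟨fun hne => ⟨(min_le_left _ _).trans (h x hx hne).1, (h x hx hne).2.trans (le_max_left _ _)⟩,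
      fun hne => ⟨(min_le_right _ _).trans (h' x hx hne).1,
        (h' x hx hne).2.trans (le_max_right _ _)⟩⟩⟩
  have hconj : ∀ u h : Q, ∀ p q : ℝ, (∀ x ∈ Ioo z y, α u x ≠ x → p ≤ x ∧ x ≤ q) →
      ∀ x ∈ Ioo z y, α (h * u⁻¹ * h⁻¹) x ≠ x → α h p ≤ x ∧ x ≤ α h q := by
    intro u h p q hu x hx hne
    have hx' : α h (α h⁻¹ x) = x := by rw [map_inv, RelIso.apply_inv_self]
    have h1 : α u (α h⁻¹ x) ≠ α h⁻¹ x := by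
      intro heq
      apply hne
      have h2 := inv_apply_eq_self heq
      rw [map_mul, map_mul, RelIso.mul_apply, RelIso.mul_apply, map_inv α u, h2, hx']
    have h2 := hu _ (hmem h⁻¹ x hx) h1
    exact ⟨((α h).monotone h2.1).trans_eq hx', hx'.symm.trans_le ((α h).monotone h2.2)⟩
  have hdisj : ∀ u v : Q, (∀ x ∈ Ioo z y, α u x = x ∨ α v x = x) → Commute (ρ u) (ρ v) := by
    intro u v huv
    apply Equiv.Perm.Disjoint.commute
    intro x
    exact (huv x x.2).imp (fun h => Subtype.ext h) fun h => Subtype.ext h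
  obtain ⟨n, hn⟩ := (Group.isSolvable_def Q).1 hsolv
  have habel : ∀ u ∈ commutator Q, ∀ v ∈ commutator Q, Commute (ρ u) (ρ v) := by
    intro u hu v hv
    obtain ⟨w, hw, hρ⟩ := exists_mem_derivedSeries_map_eq ρ (commutator Q : Set Q) (by
      intro u hu v hv
      obtain ⟨p, hp, q, hq, hpq⟩ := hsupp2 u hu v hv
      obtain ⟨h, hh, hlt⟩ := hdisp p hp q hq
      obtain ⟨k, hk, hlt'⟩ := hdisp p hp (max q (α h q)) (by
        rcases max_choice q (α h q) with e | e <;> rw [e]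
        exacts [hq, hmem h q hq])
      have hu' := hconj u h p q fun x hx => (hpq x hx).1
      have hv' := hconj v k p q fun x hx => (hpq x hx).2
      refine ⟨h, hh, k, hk, hdisj _ _ fun x hx => ?_, hdisj _ _ fun x hx => ?_,
        hdisj _ _ fun x hx => ?_⟩
      · by_contra! hcon
        exact absurd (hu' x hx hcon.1).1 (((hpq x hx).2 hcon.2).2.trans_lt hlt).not_ge
      · by_contra! hcon
        exact absurd (hv' x hx hcon.2).1
          (((hu' x hx hcon.1).2.trans (le_max_right q _)).trans_lt hlt').not_ge
      · by_contra! hcon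
        exact absurd (hv' x hx hcon.1).1
          ((((hpq x hx).1 hcon.2).2.trans (le_max_left _ _)).trans_lt hlt').not_ge) n u hu v hv
    rw [hn, Subgroup.mem_bot] at hw
    rw [hw, map_one] at hρ
    exact commutatorElement_eq_one_iff_commute.1 hρ.symm
  -- An element displacing the support of a nontrivial `u` off itself cannot commute with `u`.
  obtain ⟨u, hu, hne⟩ := hno ((z + y) / 2) ⟨by linarith, by linarith⟩
  obtain ⟨p, hp, q, hq, hpq⟩ := hsupp u hu
  obtain ⟨h, hh, hlt⟩ := hdisp p hp q hq
  have hx : (z + y) / 2 ∈ Ioo z y := ⟨by linarith, by linarith⟩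
  have hcomm : α u (α h ((z + y) / 2)) = α h (α u ((z + y) / 2)) := by
    have := congrArg (fun e : Equiv.Perm (Ioo z y) => (e ⟨_, hx⟩ : ℝ)) (habel u hu h hh).eq
    exact this
  have hmove : α u (α h ((z + y) / 2)) ≠ α h ((z + y) / 2) := by
    rw [hcomm]
    exact fun e => hne ((α h).injective e)
  have h1 := (hpq _ (hmem h _ hx) hmove).2
  have h2 := (hpq _ hx hne).1
  exact absurd ((hlt.trans_le ((α h).monotone h2)).trans_le h1) (lt_irrefl _)

/-- Two orbitals overlapping without being nested generate a group that is not solvable. -/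
theorem not_isSolvable_of_transition {Q : Type*} [Group Q] (α : Q →* (ℝ ≃o ℝ))
    (hPL : ∀ q, IsPLFun (α q)) (hfix : ∀ q, ∀ x ∉ Ioo (0 : ℝ) 1, α q x = x) {f g : Q}
    (hgen : Subgroup.closure {f, g} = ⊤) {a b c d : ℝ} (hf : IsOrbital (α f) a b)
    (hg : IsOrbital (α g) c d) (hac : a < c) (hcb : c < b) (hbd : b < d) :
    ¬ Group.IsSolvable Q := by
  -- The closed invariant set of points fixed by the derived group.
  set F : Set ℝ := {x | ∀ u ∈ commutator Q, α u x = x} with hF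
  have hFinv : ∀ q : Q, ∀ x ∈ F, α q x ∈ F := by
    intro q x hx u hu
    have h1 := hx (q⁻¹ * u * q⁻¹⁻¹)
      ((inferInstance : (commutator Q).Normal).conj_mem u hu q⁻¹)
    simp only [map_mul, map_inv, inv_inv, RelIso.mul_apply] at h1
    have h2 := congrArg (α q) h1
    rwa [RelIso.apply_inv_self] at h2
  have hFpow : ∀ (q : Q) (x : ℝ), x ∈ F → ∀ (n : ℤ), (α q ^ n) x ∈ F := by
    intro q x hx n
    rw [← map_zpow]
    exact hFinv _ x hx
  have hFclosed : IsClosed F := by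
    simp only [hF, ofPred_forall]
    exact isClosed_iInter fun u => isClosed_iInter fun _ =>
      isClosed_eq (α u).continuous continuous_id
  have hcF : c ∉ F := by
    intro hc
    -- If `f ^ n` and `g⁻¹` commute at `c`, which `g` fixes, then `g` fixes the `f`-orbit of `c` and
    -- its supremum `b`.
    have hcomm : ∀ n : ℤ, α g ((α f ^ n) c) = (α f ^ n) c := by
      intro n
      have h1 := hc ⁅(f ^ n)⁻¹, g⁻¹⁆ (by
        rw [commutator_def]
        exact Subgroup.commutator_mem_commutator trivial trivial)
      simp only [commutatorElement_def, map_mul, map_inv, inv_inv, RelIso.mul_apply, hg.left] at h1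
      have h2 := congrArg (fun t => α g (α (f ^ n) t)) h1
      simp only [RelIso.apply_inv_self] at h2
      rw [← map_zpow]
      rw [← h2]
    exact hg.ne b ⟨hcb, hbd⟩ (hf.fixed_right ⟨hac, hcb⟩ hcomm)
  have hFad : ∀ x ∈ F, x ∉ Ioo a d := by
    intro x hx hxad
    have hcd : ∀ x ∈ F, x ∉ Ioo c d := fun x hx hxcd =>
      hcF fun u hu => hg.fixed_left hxcd fun n => hFpow g x hx n u hu
    rcases lt_or_ge x b with hxb | hxb
    · exact hcd b (fun u hu => hf.fixed_right ⟨hxad.1, hxb⟩ fun n => hFpow f x hx n u hu) ⟨hcb, hbd⟩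
    · exact hcd x hx ⟨hcb.trans_le hxb, hxad.2⟩
  have hA1 : BddAbove (F ∩ Iic c) := ⟨c, fun t ht => ht.2⟩
  have hA2 : BddBelow (F ∩ Ici c) := ⟨c, fun t ht => ht.2⟩
  have hzmem := (hFclosed.inter isClosed_Iic).csSup_mem ⟨min 0 c, fun u _ => hfix u _
    (fun h => h.1.not_ge (min_le_left _ _)), mem_Iic.2 (min_le_right _ _)⟩ hA1
  have hymem := (hFclosed.inter isClosed_Ici).csInf_mem ⟨max 1 c, fun u _ => hfix u _
    (fun h => h.2.not_ge (le_max_left _ _)), mem_Ici.2 (le_max_right _ _)⟩ hA2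
  have hzmax : ∀ t ∈ F, t ≤ c → t ≤ sSup (F ∩ Iic c) := fun t h1 h2 => le_csSup hA1 ⟨h1, h2⟩
  have hymin : ∀ t ∈ F, c ≤ t → sInf (F ∩ Ici c) ≤ t := fun t h1 h2 => csInf_le hA2 ⟨h1, h2⟩
  generalize sSup (F ∩ Iic c) = z at hzmem hzmax
  generalize sInf (F ∩ Ici c) = y at hymem hymin
  obtain ⟨hzF, hzc : z ≤ c⟩ := hzmem
  obtain ⟨hyF, hcy : c ≤ y⟩ := hymem
  have hza : z ≤ a := by
    by_contra! h
    exact hFad z hzF ⟨h, hzc.trans_lt (hcb.trans hbd)⟩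
  have hdy : d ≤ y := by
    by_contra! h
    exact hFad y hyF ⟨hac.trans_le hcy, h⟩
  have hgap : ∀ x ∈ Ioo z y, x ∉ F := by
    intro x hx hxF
    rcases le_total x c with h | h
    · exact hx.1.not_ge (hzmax x hxF h)
    · exact hx.2.not_ge (hymin x hxF h)
  -- An element with a fixed point in the gap `(z, y)` of `F` preserves this gap.
  have hends : ∀ q : Q, ∀ t ∈ Ioo z y, α q t = t → α q z = z ∧ α q y = y := by
    have key : ∀ q : Q, ∀ t ∈ Ioo z y, α q t = t → α q z ≤ z ∧ y ≤ α q y := by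
      intro q t ht hqt
      constructor
      · by_contra! h
        exact hgap _ ⟨h, ((α q).strictMono ht.1).trans (hqt.symm ▸ ht.2)⟩ (hFinv q z hzF)
      · by_contra! h
        refine hgap _ ⟨?_, h⟩ (hFinv q y hyF)
        exact ht.1.trans (hqt ▸ (α q).strictMono ht.2)
    intro q t ht hqt
    have h1 := key q t ht hqt
    have h2 := key q⁻¹ t ht (by rw [map_inv]; exact inv_apply_eq_self hqt)
    rw [map_inv] at h2
    have h3 := (α q).monotone h2.1
    have h4 := (α q).monotone h2.2
    rw [RelIso.apply_inv_self] at h3 h4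
    exact ⟨le_antisymm h1.1 h3, le_antisymm h4 h1.2⟩
  have hle : Subgroup.closure {f, g} ≤ (fixer z ⊓ fixer y).comap α := by
    rw [Subgroup.closure_le]
    rintro q (rfl | rfl)
    · exact hends _ b ⟨hza.trans_lt hf.lt, hbd.trans_le hdy⟩ hf.right
    · exact hends _ c ⟨hza.trans_lt hac, hg.lt.trans_le hdy⟩ hg.left
  rw [hgen] at hle
  refine not_isSolvable_of_commutator_moves α hPL (z := z) (y := y)
    ((hza.trans_lt hac).trans (hg.lt.trans_le hdy)) (fun q => (hle (Subgroup.mem_top q)).1)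
    (fun q => (hle (Subgroup.mem_top q)).2) fun x hx => ?_
  have := hgap x hx
  simpa [hF] using this

/-! ### The laminar family of orbitals -/

/-- A group of piecewise linear automorphisms of the line supported in `[0, 1]`, any two of whose
orbitals are disjoint or weakly nested. -/
structure IsLaminarPLGroup (Γ : Subgroup (ℝ ≃o ℝ)) : Prop where
  isPLFun : ∀ g ∈ Γ, IsPLFun g
  apply_eq_self : ∀ g ∈ Γ, ∀ x ∉ Ioo (0 : ℝ) 1, g x = x
  not_transition : ∀ f ∈ Γ, ∀ g ∈ Γ, ∀ a b c d : ℝ, IsOrbital f a b → IsOrbital g c d →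
    a < c → c < b → ¬ b < d

namespace IsLaminarPLGroup

variable {Γ : Subgroup (ℝ ≃o ℝ)} (hΓ : IsLaminarPLGroup Γ)
include hΓ

theorem exists_isOrbital {g : ℝ ≃o ℝ} (hg : g ∈ Γ) {p : ℝ} (hp : g p ≠ p) :
    ∃ a b, IsOrbital g a b ∧ p ∈ Ioo a b := by
  obtain ⟨a, b, h, hp, -, -⟩ := _root_.exists_isOrbital hp (x := min 0 p) (y := max 1 p)
    (hΓ.apply_eq_self g hg _ fun h => h.1.not_ge (min_le_left _ _)) (min_le_right _ _)
    (hΓ.apply_eq_self g hg _ fun h => h.2.not_ge (le_max_left _ _)) (le_max_right _ _)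
  exact ⟨a, b, h, hp⟩


/-- Two orbitals with the same left end have the same right end. Otherwise the commutator of the two
elements, which is trivial near the common end, has an orbital overlapping the shorter one. -/
theorem not_lt_of_left_eq {f g : ℝ ≃o ℝ} (hf : f ∈ Γ) (hg : g ∈ Γ) {a b d : ℝ}
    (hfo : IsOrbital f a b) (hgo : IsOrbital g a d) : ¬ b < d := by
  intro hbd
  have key : ∀ g ∈ Γ, IsOrbital g a d → b < g b → False := by
    intro g hg hgo hlt
    have hmem : ⁅g, f⁆ ∈ Γ := by
      rw [commutatorElement_def]
      exact Γ.mul_mem (Γ.mul_mem (Γ.mul_mem hg hf) (Γ.inv_mem hg)) (Γ.inv_mem hf)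
    have hfinv : f⁻¹ b = b := inv_apply_eq_self hfo.right
    have hlt' : g⁻¹ b < b := by
      rw [← g.lt_iff_lt, RelIso.apply_inv_self]; exact hlt
    have hgb : g⁻¹ b ∈ Ioo a b := ⟨(hgo.inv.apply_mem ⟨hfo.lt, hbd⟩).1, hlt'⟩
    have hne : ⁅g, f⁆ b ≠ b := by
      change g (f (g⁻¹ (f⁻¹ b))) ≠ b
      rw [hfinv]
      intro h
      apply hfo.ne _ hgb
      apply g.injective
      rw [h, RelIso.apply_inv_self]
    obtain ⟨x, y, hxy, hbxy⟩ := hΓ.exists_isOrbital hmem hne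
    have hgerm := eventually_commutator_right (hΓ.isPLFun _ (Γ.inv_mem hg))
      (hΓ.isPLFun _ (Γ.inv_mem hf)) hgo.left hfo.left
    obtain ⟨t, ht, hat⟩ := (hgerm.and (Ioo_mem_nhdsGT hfo.lt)).exists
    have hax : a < x := by
      refine hat.1.trans_le ?_
      by_contra! h
      exact hxy.ne t ⟨h, hat.2.trans hbxy.2⟩ ht
    exact hΓ.not_transition f hf _ hmem a b x y hfo hxy hax hbxy.1 hbxy.2
  rcases lt_or_gt_of_ne (hgo.ne b ⟨hfo.lt, hbd⟩) with h | h
  · refine key g⁻¹ (Γ.inv_mem hg) hgo.inv ?_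
    rw [← g.lt_iff_lt, RelIso.apply_inv_self]; exact h
  · exact key g hg hgo h

theorem not_lt_of_right_eq {f g : ℝ ≃o ℝ} (hf : f ∈ Γ) (hg : g ∈ Γ) {a b d : ℝ}
    (hfo : IsOrbital f b a) (hgo : IsOrbital g d a) : ¬ d < b := by
  intro hbd
  have key : ∀ g ∈ Γ, IsOrbital g d a → g b < b → False := by
    intro g hg hgo hlt
    have hmem : ⁅g, f⁆ ∈ Γ := by
      rw [commutatorElement_def]
      exact Γ.mul_mem (Γ.mul_mem (Γ.mul_mem hg hf) (Γ.inv_mem hg)) (Γ.inv_mem hf)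
    have hfinv : f⁻¹ b = b := inv_apply_eq_self hfo.left
    have hlt' : b < g⁻¹ b := by
      rw [← g.lt_iff_lt, RelIso.apply_inv_self]; exact hlt
    have hgb : g⁻¹ b ∈ Ioo b a := ⟨hlt', (hgo.inv.apply_mem ⟨hbd, hfo.lt⟩).2⟩
    have hne : ⁅g, f⁆ b ≠ b := by
      change g (f (g⁻¹ (f⁻¹ b))) ≠ b
      rw [hfinv]
      intro h
      apply hfo.ne _ hgb
      apply g.injective
      rw [h, RelIso.apply_inv_self]
    obtain ⟨x, y, hxy, hbxy⟩ := hΓ.exists_isOrbital hmem hne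
    have hgerm := eventually_commutator_left (hΓ.isPLFun _ (Γ.inv_mem hg))
      (hΓ.isPLFun _ (Γ.inv_mem hf)) hgo.right hfo.right
    obtain ⟨t, ht, hat⟩ := (hgerm.and (Ioo_mem_nhdsLT hfo.lt)).exists
    have hax : y < a := by
      refine lt_of_le_of_lt ?_ hat.2
      by_contra! h
      exact hxy.ne t ⟨hbxy.1.trans hat.1, h⟩ ht
    exact hΓ.not_transition _ hmem f hf x y b a hxy hfo hbxy.1 hbxy.2 hax
  rcases lt_or_gt_of_ne (hgo.ne b ⟨hbd, hfo.lt⟩) with h | h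
  · exact key g hg hgo h
  · refine key g⁻¹ (Γ.inv_mem hg) hgo.inv ?_
    rw [← g.lt_iff_lt, RelIso.apply_inv_self]; exact h

/-- An element moves every orbital strictly inside one of its own orbitals off itself. -/
theorem apply_notMem {g k : ℝ ≃o ℝ} (hg : g ∈ Γ) (hk : k ∈ Γ) {a b c d : ℝ} (hgo : IsOrbital g a b)
    (hko : IsOrbital k c d) (hac : a < c) (hdb : d < b) {p : ℝ} (hp : p ∈ Ioo c d) :
    g p ∉ Ioo c d := by
  have hmem : ∀ {x}, x ∈ Icc c d → x ∈ Ioo a b := fun hx =>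
    ⟨hac.trans_le hx.1, hx.2.trans_lt hdb⟩
  -- If `g` moves points to the left and `g (c, d)` meets `(c, d)`, then these two orbitals overlap
  -- without being nested.
  have key : ∀ g ∈ Γ, IsOrbital g a b → (∀ x ∈ Ioo a b, g x < x) → ∀ p ∈ Ioo c d,
      g p ∉ Ioo c d := by
    intro g hg hgo hlt p hp hgp
    exact hΓ.not_transition _ (Γ.mul_mem (Γ.mul_mem hg hk) (Γ.inv_mem hg)) k hk _ _ c d
      (hko.conj g) hko (hlt c (hmem ⟨le_rfl, hko.lt.le⟩)) (hgp.1.trans (g.strictMono hp.2))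
      (hlt d (hmem ⟨hko.lt.le, le_rfl⟩))
  have hpab := hmem (Ioo_subset_Icc_self hp)
  rcases lt_or_gt_of_ne (hgo.ne p hpab) with h | h
  · exact key g hg hgo (fun x hx => hgo.lt_of_lt hpab hx h) p hp
  · intro hgp
    refine key g⁻¹ (Γ.inv_mem hg) hgo.inv (fun x hx => hgo.inv.lt_of_lt hpab hx ?_) (g p) hgp
      (by simpa using hp)
    rw [← g.lt_iff_lt, RelIso.apply_inv_self]; exact h

/-- There are countably many left ends of orbitals. Orbitals around a given point `q` form a chain,
and each of them, being the orbital of `g`, say, leaves a gap to the left of `g q` or `g⁻¹ q`,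
which is free of left ends of smaller members of the chain. -/
theorem countable_left_ends : {a : ℝ | ∃ g ∈ Γ, ∃ b, IsOrbital g a b}.Countable := by
  have hq : ∀ q : ℚ, {a : ℝ | ∃ g ∈ Γ, ∃ b, IsOrbital g a b ∧ (q : ℝ) ∈ Ioo a b}.Countable := by
    intro q
    set A := {a : ℝ | ∃ g ∈ Γ, ∃ b, IsOrbital g a b ∧ (q : ℝ) ∈ Ioo a b}
    have hr : ∀ a ∈ A, ∃ r : ℚ, a < r ∧ ∀ a' ∈ A, a < a' → (r : ℝ) < a' := by
      rintro a ⟨g, hg, b, hgo, hqab⟩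
      have h1 := hgo.apply_mem hqab
      have h2 := hgo.inv.apply_mem hqab
      obtain ⟨r, hr1, hr2⟩ := exists_rat_btwn (lt_min h1.1 h2.1)
      refine ⟨r, hr1, ?_⟩
      rintro a' ⟨k, hk, b', hko, hqab'⟩ haa'
      refine hr2.trans_le ?_
      have hb' : b' < b := by
        refine lt_of_le_of_ne ?_ ?_
        · exact not_lt.1 (hΓ.not_transition g hg k hk a b a' b' hgo hko haa'
            (hqab'.1.trans hqab.2))
        · rintro rfl
          exact hΓ.not_lt_of_right_eq hk hg hko hgo haa'
      have h3 := hΓ.apply_notMem hg hk hgo hko haa' hb' hqab'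
      have h4 := hΓ.apply_notMem (Γ.inv_mem hg) hk hgo.inv hko haa' hb' hqab'
      by_contra! hlt
      rw [lt_min_iff] at hlt
      rcases lt_or_gt_of_ne (hgo.ne q hqab) with h | h
      · exact h3 ⟨hlt.1, h.trans hqab'.2⟩
      · refine h4 ⟨hlt.2, lt_trans ?_ hqab'.2⟩
        rw [← g.lt_iff_lt, RelIso.apply_inv_self]; exact h
    choose! r hr1 hr2 using hr
    refine MapsTo.countable_of_injOn (f := r) (mapsTo_univ r A) ?_ (to_countable _)
    intro a ha a' ha' heq
    by_contra hne
    rcases lt_or_gt_of_ne hne with h | h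
    · exact absurd (heq ▸ hr2 a ha a' ha' h) (hr1 a' ha').not_gt
    · exact absurd (heq ▸ hr2 a' ha' a ha h) (hr1 a ha).not_gt
  refine (countable_iUnion hq).mono ?_
  rintro a ⟨g, hg, b, hgo⟩
  obtain ⟨q, hq1, hq2⟩ := exists_rat_btwn hgo.lt
  exact mem_iUnion.2 ⟨q, g, hg, b, hgo, hq1, hq2⟩

end IsLaminarPLGroup

/-! ### Breakpoints -/

/-- `g` is affine in a neighbourhood of `x`, that is, `x` is not a breakpoint of `g`. -/
def IsAffineAt (g : ℝ → ℝ) (x : ℝ) : Prop :=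
  ∃ a b : ℝ, ∀ᶠ z in 𝓝 x, g z = a * z + b

/-- The set of breakpoints of `g`. -/
def breakpoints (g : ℝ → ℝ) : Set ℝ := {x | ¬ IsAffineAt g x}

theorem isAffineAt_of_mem_Ioo {g : ℝ → ℝ} {x y z a b : ℝ} (h : ∀ z ∈ Icc x y, g z = a * z + b)
    (hz : z ∈ Ioo x y) : IsAffineAt g z :=
  ⟨a, b, by filter_upwards [Ioo_mem_nhds hz.1 hz.2] with t ht using h t (Ioo_subset_Icc_self ht)⟩

theorem IsPLFun.finite_breakpoints {g : ℝ → ℝ} (hg : IsPLFun g) : (breakpoints g).Finite := by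
  obtain ⟨B, hB, h⟩ := hg
  refine hB.subset fun x hx => ?_
  by_contra hxB
  obtain ⟨l, u, hlu, hsub⟩ := mem_nhds_iff_exists_Ioo_subset.1
    (hB.isClosed.isOpen_compl.mem_nhds hxB)
  obtain ⟨a, b, hab⟩ := h l u (Set.disjoint_left.2 fun z hz => hsub hz)
  exact hx (isAffineAt_of_mem_Ioo hab hlu)

theorem IsAffineAt.comp {g h : ℝ → ℝ} {x : ℝ} (hg : IsAffineAt g (h x)) (hh : IsAffineAt h x) :
    IsAffineAt (fun z => g (h z)) x := by
  obtain ⟨a, b, hab⟩ := hg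
  obtain ⟨c, d, hcd⟩ := hh
  have hcont : Tendsto h (𝓝 x) (𝓝 (h x)) := by
    have : Tendsto (fun z => c * z + d) (𝓝 x) (𝓝 (c * x + d)) := by
      apply Continuous.tendsto
      fun_prop
    rw [hcd.self_of_nhds]
    exact this.congr' (hcd.mono fun z hz => hz.symm)
  refine ⟨a * c, a * d + b, ?_⟩
  filter_upwards [hcd, hcont.eventually hab] with z h1 h2
  rw [h2, h1]
  ring

theorem IsAffineAt.inv {g : ℝ ≃o ℝ} {x : ℝ} (hg : IsAffineAt g x) : IsAffineAt ⇑g⁻¹ (g x) := by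
  obtain ⟨a, b, hab⟩ := hg
  have ha : a ≠ 0 := by
    rintro rfl
    have h1 : ∀ᶠ z in 𝓝[>] x, g z = 0 * z + b := hab.filter_mono nhdsWithin_le_nhds
    obtain ⟨z, hz, hxz⟩ := (h1.and self_mem_nhdsWithin).exists
    have h2 := hab.self_of_nhds
    exact (g.strictMono hxz).ne (by rw [hz, h2]; ring)
  have hcont : Tendsto ⇑g⁻¹ (𝓝 (g x)) (𝓝 x) := by
    have := g⁻¹.continuous.tendsto (g x)
    rwa [RelIso.inv_apply_self] at this
  refine ⟨a⁻¹, -(a⁻¹ * b), ?_⟩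
  filter_upwards [hcont.eventually hab] with z hz
  rw [RelIso.apply_inv_self] at hz
  have h1 : g⁻¹ z = (z - b) / a := by
    rw [eq_div_iff ha]
    linarith
  rw [h1]
  ring

theorem exists_affine_of_isAffineAt {g : ℝ → ℝ} {u v : ℝ} (h : ∀ x ∈ Ioo u v, IsAffineAt g x) :
    ∃ m n : ℝ, ∀ z ∈ Ioo u v, g z = m * z + n := by
  have hder : ∀ x ∈ Ioo u v, ∃ a : ℝ, ∀ᶠ z in 𝓝 x, HasDerivAt g a z := by
    intro x hx
    obtain ⟨a, b, hab⟩ := h x hx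
    refine ⟨a, hab.eventually_nhds.mono fun z hz => ?_⟩
    have : HasDerivAt (fun z => a * z + b) a z := by
      simpa using ((hasDerivAt_id z).const_mul a).add_const b
    exact this.congr_of_eventuallyEq hz
  have hder2 : ∀ x ∈ Ioo u v, HasDerivAt (deriv g) 0 x := by
    intro x hx
    obtain ⟨a, ha⟩ := hder x hx
    exact (hasDerivAt_const x a).congr_of_eventuallyEq (ha.mono fun z hz => hz.deriv)
  obtain ⟨m, hm⟩ := isOpen_Ioo.exists_is_const_of_deriv_eq_zero isPreconnected_Ioo
    (fun x hx => (hder2 x hx).differentiableAt.differentiableWithinAt)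
    (fun x hx => (hder2 x hx).deriv)
  have hder3 : ∀ x ∈ Ioo u v, HasDerivAt (fun z => g z - m * z) 0 x := by
    intro x hx
    obtain ⟨a, ha⟩ := hder x hx
    have h1 := ha.self_of_nhds
    have h2 : a = m := by rw [← hm x hx, h1.deriv]
    subst h2
    have h2 := h1.sub ((hasDerivAt_id x).const_mul a)
    rw [mul_one, sub_self] at h2
    exact h2
  obtain ⟨n, hn⟩ := isOpen_Ioo.exists_is_const_of_deriv_eq_zero isPreconnected_Ioo
    (fun x hx => (hder3 x hx).differentiableAt.differentiableWithinAt)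
    (fun x hx => (hder3 x hx).deriv)
  exact ⟨m, n, fun z hz => by linarith [hn z hz]⟩

/-- High powers of an element with orbital `(e, b)` have breakpoints near `b` whose images are near
`e`, because the slopes at the two ends differ. At such a breakpoint a commuting element `u` is affine
at both the point and its image, so it maps the breakpoint to another breakpoint. -/
theorem exists_breakpoint_zpow {f u : ℝ ≃o ℝ} (hf : IsPLFun f) (hu : IsPLFun u) {e b : ℝ}
    (hfo : IsOrbital f e b) (hlt : ∀ x ∈ Ioo e b, f x < x)
    (hcomm : ∀ n : ℤ, ∀ x ∈ Ioo e b, u ((f ^ n) x) = (f ^ n) (u x)) :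
    ∃ n : ℤ, ∃ x ∈ Ioo e b, x ∈ breakpoints ⇑(f ^ n) ∧ u x ∈ breakpoints ⇑(f ^ n) := by
  obtain ⟨s, y₁, hy₁, hs⟩ := hf.exists_right e
  obtain ⟨t, y₂, hy₂, ht⟩ := hf.exists_left b
  obtain ⟨s', y₃, hy₃, hs'⟩ := hu.exists_right e
  obtain ⟨t', y₄, hy₄, ht'⟩ := hu.exists_left b
  rw [hfo.left] at hs
  rw [hfo.right] at ht
  have heb := hfo.lt
  set p := min (min y₁ y₃) ((e + b) / 2)
  set x₁ := max (max y₂ y₄) ((e + b) / 2)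
  have hp : p ∈ Ioo e b := ⟨lt_min (lt_min hy₁ hy₃) (by linarith),
    (min_le_right _ _).trans_lt (by linarith)⟩
  have hpy₁ : p ≤ y₁ := (min_le_left _ _).trans (min_le_left _ _)
  have hpy₃ : p ≤ y₃ := (min_le_left _ _).trans (min_le_right _ _)
  have hx₁ : x₁ ∈ Ioo e b := ⟨lt_of_lt_of_le (by linarith) (le_max_right _ _),
    max_lt (max_lt hy₂ hy₄) (by linarith)⟩
  have hy₂x : y₂ ≤ x₁ := (le_max_left _ _).trans (le_max_left _ _)
  have hy₄x : y₄ ≤ x₁ := (le_max_right _ _).trans (le_max_left _ _)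
  have hinv : ∀ x ∈ Ioo e b, x < f⁻¹ x := fun x hx => by
    have := hlt _ (hfo.inv.apply_mem hx)
    rwa [RelIso.apply_inv_self] at this
  set x₂ := f⁻¹ x₁ with hx₂def
  have hx₂ : x₂ ∈ Ioo e b := hfo.inv.apply_mem hx₁
  set x₃ := f⁻¹ x₂ with hx₃def
  have hx₃ : x₃ ∈ Ioo e b := hfo.inv.apply_mem hx₂
  have h12 : x₁ < x₂ := hinv _ hx₁
  have h23 : x₂ < x₃ := hinv _ hx₂
  have hf2 : f x₂ = x₁ := by rw [hx₂def, RelIso.apply_inv_self]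
  have hf3 : f x₃ = x₂ := by rw [hx₃def, RelIso.apply_inv_self]
  obtain ⟨n, hn⟩ := hfo.exists_zpow_lt hx₃ hp
  have hgp : ∀ x ∈ Ioo e b, x ≤ x₃ → (f ^ n) x ∈ Ioo e p := fun x hx h =>
    ⟨(hfo.zpow_apply_mem n hx).1, ((f ^ n).monotone h).trans_lt hn⟩
  have hbreak : ∃ x ∈ Ioo x₁ x₃, x ∈ breakpoints ⇑(f ^ n) := by
    by_contra! hno
    obtain ⟨m, k, hmk⟩ := exists_affine_of_isAffineAt (g := ⇑(f ^ n)) (u := x₁) (v := x₃)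
      fun x hx => not_not.1 (hno x hx)
    -- Comparing `f ^ n ∘ f` and `f ∘ f ^ n` on `(x₂, x₃)` shows that the slopes `s` and `t` of `f`
    -- at the two ends are equal.
    have heq : ∀ z ∈ Ioo x₂ x₃, m * (b + t * (z - b)) + k = e + s * (m * z + k - e) := by
      intro z hz
      have hz1 : z ∈ Ioo x₁ x₃ := ⟨h12.trans hz.1, hz.2⟩
      have hz2 : z ∈ Ioo e b := ⟨hx₂.1.trans hz.1, hz.2.trans hx₃.2⟩
      have hfz : f z ∈ Ioo x₁ x₃ :=
        ⟨hf2 ▸ f.strictMono hz.1, (hf3 ▸ f.strictMono hz.2 : f z < x₂).trans h23⟩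
      have h1 := hmk _ hfz
      rw [ht z ⟨hy₂x.trans hz1.1.le, hz2.2.le⟩] at h1
      have h2 := hgp z hz2 hz.2.le
      have h3 := hs _ ⟨h2.1.le, h2.2.le.trans hpy₁⟩
      rw [hmk z hz1] at h3
      rw [← h1, ← h3, ← hmk z hz1, ← ht z ⟨hy₂x.trans hz1.1.le, hz2.2.le⟩]
      exact congrArg (fun e : ℝ ≃o ℝ => e z) ((Commute.refl f).zpow_left n).eq
    obtain ⟨z₁, hz₁⟩ := exists_between h23
    obtain ⟨z₂, hz₂⟩ := exists_between hz₁.2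
    have hm : 0 < m * (z₂ - z₁) := by
      have h1 := hmk z₁ ⟨h12.trans hz₁.1, hz₁.2⟩
      have h2 := hmk z₂ ⟨h12.trans (hz₁.1.trans hz₂.1), hz₂.2⟩
      have h3 := (f ^ n).strictMono hz₂.1
      rw [h1, h2] at h3
      linarith
    have h1 := heq z₁ hz₁
    have h2 := heq z₂ ⟨hz₁.1.trans hz₂.1, hz₂.2⟩
    have hst : (t - s) * (m * (z₂ - z₁)) = 0 := by linear_combination h2 - h1
    have hst' : t = s := by
      rcases mul_eq_zero.1 hst with h | h
      · linarith
      · exact absurd h hm.ne'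
    have hs1 : s < 1 := by
      have h3 := hlt p hp
      rw [hs p ⟨hp.1.le, hpy₁⟩] at h3
      have h4 := hp.1
      by_contra! h5
      nlinarith
    have ht1 : 1 < t := by
      have h3 := hlt x₁ hx₁
      rw [ht x₁ ⟨hy₂x, hx₁.2.le⟩] at h3
      have h4 := hx₁.2
      by_contra! h5
      nlinarith
    linarith
  obtain ⟨x, hx, hxbreak⟩ := hbreak
  have hxeb : x ∈ Ioo e b := ⟨hx₁.1.trans hx.1, hx.2.trans hx₃.2⟩
  refine ⟨n, x, hxeb, hxbreak, fun haff => hxbreak ?_⟩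
  have hgx := hgp x hxeb hx.2.le
  have hu₁ : IsAffineAt u x := by
    obtain ⟨c, hc⟩ : ∃ c, ∀ z ∈ Icc y₄ b, u z = t' * z + c :=
      ⟨u b - t' * b, fun z hz => by rw [ht' z hz]; ring⟩
    exact isAffineAt_of_mem_Ioo hc ⟨hy₄x.trans_lt hx.1, hxeb.2⟩
  have hu₂ : IsAffineAt u ((f ^ n) x) := by
    obtain ⟨c, hc⟩ : ∃ c, ∀ z ∈ Icc e y₃, u z = s' * z + c :=
      ⟨u e - s' * e, fun z hz => by rw [hs' z hz]; ring⟩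
    exact isAffineAt_of_mem_Ioo hc ⟨hgx.1, hgx.2.trans_le hpy₃⟩
  have hu₃ : IsAffineAt ⇑u⁻¹ ((f ^ n) (u x)) := by
    rw [← hcomm n x hxeb]
    exact hu₂.inv
  obtain ⟨a', b', hab⟩ := hu₃.comp (h := fun z => (f ^ n) (u z)) (haff.comp hu₁)
  refine ⟨a', b', ?_⟩
  filter_upwards [hab, Ioo_mem_nhds hxeb.1 hxeb.2] with z hz hz'
  rw [← hz, ← hcomm n z hz', RelIso.inv_apply_self]

/-! ### Countability of the germs at a point -/

/-- An injective labelling of germs by a countable set makes the set of slopes countable. -/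
theorem countable_slopes_of_label {β : Type*} {e : ℝ} {W : Set (ℝ ≃o ℝ)} {R : Set β}
    (hR : R.Countable) (r : (ℝ ≃o ℝ) → β) (hr : ∀ u ∈ W, r u ∈ R)
    (h : ∀ u ∈ W, ∀ w ∈ W, r u = r w → u⁻¹ * w ∈ germFixer (𝓝[>] e)) :
    {s : ℝ | ∃ u ∈ W, ∀ᶠ z in 𝓝[>] e, u z = e + s * (z - e)}.Countable := by
  set V := {s : ℝ | ∃ u ∈ W, ∀ᶠ z in 𝓝[>] e, u z = e + s * (z - e)}
  have hV : ∀ s ∈ V, ∃ u ∈ W, ∀ᶠ z in 𝓝[>] e, u z = e + s * (z - e) := fun s hs => hs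
  choose! u huW hu using hV
  refine MapsTo.countable_of_injOn (f := fun s => r (u s)) (t := R) (fun s hs => hr _ (huW s hs))
    ?_ hR
  intro s hs t ht hst
  have hgerm : ∀ᶠ z in 𝓝[>] e, (u s)⁻¹ (u t z) = z :=
    h _ (huW s hs) _ (huW t ht) hst
  obtain ⟨z, ⟨⟨h1, h2⟩, h3⟩, h4 : e < z⟩ :=
    (((hgerm.and (hu s hs)).and (hu t ht)).and self_mem_nhdsWithin).exists
  have h5 : u t z = u s z := by
    rw [← (u s)⁻¹.injective.eq_iff, h1, RelIso.inv_apply_self]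
  rw [h2, h3] at h5
  have h6 : (t - s) * (z - e) = 0 := by linear_combination h5
  rcases mul_eq_zero.1 h6 with h | h <;> linarith

namespace IsLaminarPLGroup

variable {Γ : Subgroup (ℝ ≃o ℝ)} (hΓ : IsLaminarPLGroup Γ)
include hΓ

theorem exists_isOrbital_left {u : ℝ ≃o ℝ} (hu : u ∈ Γ) {e : ℝ} (he : u e = e)
    (hgerm : u ∉ germFixer (𝓝[>] e)) : ∃ b, IsOrbital u e b := by
  obtain ⟨s, y, hy, hs⟩ := (hΓ.isPLFun u hu).exists_right e
  rw [he] at hs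
  have hs1 : s ≠ 1 := by
    rintro rfl
    refine hgerm ?_
    rw [mem_germFixer]
    filter_upwards [Ioo_mem_nhdsGT hy] with z hz
    rw [hs z (Ioo_subset_Icc_self hz)]
    ring
  have hmove : ∀ z, e < z → z ≤ y → u z ≠ z := by
    intro z h1 h2 h3
    rw [hs z ⟨h1.le, h2⟩] at h3
    have h4 : (s - 1) * (z - e) = 0 := by linear_combination h3
    rcases mul_eq_zero.1 h4 with h | h
    · exact hs1 (by linarith)
    · linarith
  obtain ⟨a, b, h, hyab, hea, -⟩ := _root_.exists_isOrbital (hmove y hy le_rfl) he hy.le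
    (hΓ.apply_eq_self u hu (max 1 y) fun h => h.2.not_ge (le_max_left _ _)) (le_max_right _ _)
  rcases hea.eq_or_lt with rfl | hlt
  · exact ⟨b, h⟩
  · exact absurd h.left (hmove a hlt hyab.1.le)

/-- The slopes at `e` of the elements fixing `e` form a countable set. The elements with nontrivial
germ at `e` share one orbital `(e, b)`. Either a smaller orbital lies in `(e, b)`, and its images
under elements with distinct germs are disjoint; or the elements fixing `e` and `b` commute on
`(e, b)`, and each is determined by its effect on one breakpoint of a power of a fixed one. -/
theorem countable_right_slopes (e : ℝ) :
    {s : ℝ | ∃ u ∈ Γ, u e = e ∧ ∀ᶠ z in 𝓝[>] e, u z = e + s * (z - e)}.Countable := by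
  set W : Set (ℝ ≃o ℝ) := {u | u ∈ Γ ∧ u e = e ∧ u ∉ germFixer (𝓝[>] e)} with hW
  suffices h : {s : ℝ | ∃ u ∈ W, ∀ᶠ z in 𝓝[>] e, u z = e + s * (z - e)}.Countable by
    refine (h.insert 1).mono ?_
    rintro s ⟨u, hu, he, hs⟩
    by_cases hs1 : u ∈ germFixer (𝓝[>] e)
    · left
      obtain ⟨z, ⟨h1, h2⟩, h3 : e < z⟩ := ((hs.and hs1).and self_mem_nhdsWithin).exists
      rw [h2] at h1
      have h4 : (s - 1) * (z - e) = 0 := by linear_combination -h1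
      rcases mul_eq_zero.1 h4 with h | h <;> linarith
    · exact Or.inr ⟨u, ⟨hu, he, hs1⟩, hs⟩
  rcases W.eq_empty_or_nonempty with hemp | ⟨f₀, hf₀⟩
  · rw [hemp]; simp
  obtain ⟨b, hf₀o⟩ := hΓ.exists_isOrbital_left hf₀.1 hf₀.2.1 hf₀.2.2
  have horb : ∀ u ∈ W, IsOrbital u e b := by
    intro u hu
    obtain ⟨b', hb'⟩ := hΓ.exists_isOrbital_left hu.1 hu.2.1 hu.2.2
    have h1 := hΓ.not_lt_of_left_eq hf₀.1 hu.1 hf₀o hb'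
    have h2 := hΓ.not_lt_of_left_eq hu.1 hf₀.1 hb' hf₀o
    rwa [le_antisymm (not_lt.1 h1) (not_lt.1 h2)] at hb'
  have horb' : ∀ u ∈ W, ∀ w ∈ W, u⁻¹ * w ∉ germFixer (𝓝[>] e) → IsOrbital (u⁻¹ * w) e b :=
    fun u hu w hw h => horb _ ⟨Γ.mul_mem (Γ.inv_mem hu.1) hw.1,
      (fixer e).mul_mem ((fixer e).inv_mem hu.2.1) hw.2.1, h⟩
  by_cases hcase : ∃ k ∈ Γ, k e = e ∧ k b = b ∧ k ∈ germFixer (𝓝[>] e) ∧ ∃ p ∈ Ioo e b, k p ≠ p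
  · obtain ⟨k, hk, hke, hkb, hkgerm, p, hp, hkp⟩ := hcase
    obtain ⟨c, d, hko, hpcd, hec, hdb⟩ := _root_.exists_isOrbital hkp hke hp.1.le hkb hp.2.le
    have hec' : e < c := by
      refine lt_of_le_of_ne hec ?_
      rintro rfl
      obtain ⟨z, h1, h2⟩ := ((mem_germFixer.1 hkgerm).and (Ioo_mem_nhdsGT hko.lt)).exists
      exact hko.ne z h2 h1
    have hdb' : d < b := by
      refine lt_of_le_of_ne hdb ?_
      rintro rfl
      exact hΓ.not_lt_of_right_eq hk hf₀.1 hko hf₀o hec'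
    have hrat : ∀ u : ℝ ≃o ℝ, ∃ r : ℚ, (r : ℝ) ∈ Ioo (u c) (u d) := fun u =>
      exists_rat_btwn (u.strictMono hko.lt)
    choose r hr using hrat
    have hr' : ∀ u : ℝ ≃o ℝ, u⁻¹ (r u) ∈ Ioo c d := fun u => by
      constructor
      · rw [← u.lt_iff_lt, RelIso.apply_inv_self]; exact (hr u).1
      · rw [← u.lt_iff_lt, RelIso.apply_inv_self]; exact (hr u).2
    refine countable_slopes_of_label (to_countable (univ : Set ℚ)) r (fun u _ => trivial) ?_
    intro u hu w hw huw
    by_contra hgerm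
    have h1 := horb' u hu w hw hgerm
    refine hΓ.apply_notMem (Γ.mul_mem (Γ.inv_mem hu.1) hw.1) hk h1 hko hec' hdb' (hr' w) ?_
    rw [RelIso.mul_apply, RelIso.apply_inv_self, ← huw]
    exact hr' u
  · have htriv : ∀ k ∈ Γ, k e = e → k b = b → k ∈ germFixer (𝓝[>] e) →
        ∀ p ∈ Ioo e b, k p = p := by
      push Not at hcase
      exact hcase
    obtain ⟨f, hfW, hflt⟩ : ∃ f ∈ W, ∀ x ∈ Ioo e b, f x < x := by
      have hx : (e + b) / 2 ∈ Ioo e b := ⟨by linarith [hf₀o.lt], by linarith [hf₀o.lt]⟩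
      rcases lt_or_gt_of_ne (hf₀o.ne _ hx) with h | h
      · exact ⟨f₀, hf₀, fun x hx' => hf₀o.lt_of_lt hx hx' h⟩
      · refine ⟨f₀⁻¹, ⟨Γ.inv_mem hf₀.1, inv_apply_eq_self hf₀.2.1, fun hmem =>
          hf₀.2.2 (by simpa using (germFixer _).inv_mem hmem)⟩,
          fun x hx' => hf₀o.inv.lt_of_lt hx hx' ?_⟩
        rw [← f₀.lt_iff_lt, RelIso.apply_inv_self]; exact h
    have hfo := horb f hfW
    set T : Set ℝ := ⋃ n : ℤ, breakpoints ⇑(f ^ n)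
    have hT : T.Countable := countable_iUnion fun n =>
      (hΓ.isPLFun _ (Γ.zpow_mem hfW.1 n)).finite_breakpoints.countable
    have hpair : ∀ u ∈ W, ∃ x ∈ Ioo e b, x ∈ T ∧ u x ∈ T := by
      intro u hu
      have huo := horb u hu
      have hcomm : ∀ n : ℤ, ∀ x ∈ Ioo e b, u ((f ^ n) x) = (f ^ n) (u x) := by
        intro n x hx
        have hmem : ⁅u, f ^ n⁆ ∈ Γ := by
          have := Γ.zpow_mem hfW.1 n
          rw [commutatorElement_def]
          exact Γ.mul_mem (Γ.mul_mem (Γ.mul_mem hu.1 this) (Γ.inv_mem hu.1)) (Γ.inv_mem this)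
        have hfixes : ∀ t : ℝ, u t = t → (f ^ n) t = t → ⁅u, f ^ n⁆ t = t := by
          intro t h1 h2
          rw [← mem_fixer] at *
          rw [commutatorElement_def]
          exact mul_mem (mul_mem (mul_mem h1 h2) (inv_mem h1)) (inv_mem h2)
        have h1 := htriv _ hmem (hfixes e huo.left (hfo.zpow_apply_left n))
          (hfixes b huo.right (hfo.zpow_apply_right n))
          (eventually_commutator_right (hΓ.isPLFun _ (Γ.inv_mem hu.1))
            (hΓ.isPLFun _ (Γ.inv_mem (Γ.zpow_mem hfW.1 n))) huo.left (hfo.zpow_apply_left n))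
          ((f ^ n) (u x)) (hfo.zpow_apply_mem n (huo.apply_mem hx))
        rw [← h1]
        change u ((f ^ n) x) = u ((f ^ n) (u⁻¹ ((f ^ n)⁻¹ ((f ^ n) (u x)))))
        rw [RelIso.inv_apply_self, RelIso.inv_apply_self]
      obtain ⟨n, x, hx, h1, h2⟩ := exists_breakpoint_zpow (hΓ.isPLFun f hfW.1)
        (hΓ.isPLFun u hu.1) hfo hflt hcomm
      exact ⟨x, hx, mem_iUnion.2 ⟨n, h1⟩, mem_iUnion.2 ⟨n, h2⟩⟩
    choose! x hx hxT huxT using hpair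
    refine countable_slopes_of_label (hT.prod hT) (fun u => (x u, u (x u)))
      (fun u hu => ⟨hxT u hu, huxT u hu⟩) ?_
    intro u hu w hw huw
    by_contra hgerm
    obtain ⟨h1, h2⟩ := Prod.ext_iff.1 huw
    dsimp only at h1 h2
    refine (horb' u hu w hw hgerm).ne (x w) (hx w hw) ?_
    rw [RelIso.mul_apply, ← h2, ← h1, RelIso.inv_apply_self]

end IsLaminarPLGroup

/-! ### Countability of laminar groups -/

namespace IsLaminarPLGroup

variable {Γ : Subgroup (ℝ ≃o ℝ)} (hΓ : IsLaminarPLGroup Γ)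
include hΓ

/-- Two distinct elements first differ to the right of the left end `c` of an orbital, and one of
them has a breakpoint at `c`. -/
theorem exists_first_difference {g h : ℝ ≃o ℝ} (hg : g ∈ Γ) (hh : h ∈ Γ) (hne : g ≠ h) :
    ∃ c, (∃ u ∈ Γ, ∃ b, IsOrbital u c b) ∧ (∀ x ≤ c, g x = h x) ∧
      g⁻¹ * h ∉ germFixer (𝓝[>] c) ∧ (c ∈ breakpoints g ∨ c ∈ breakpoints h) := by
  set w := g⁻¹ * h with hw
  have hwΓ : w ∈ Γ := Γ.mul_mem (Γ.inv_mem hg) hh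
  have hgw : ∀ x, w x = x → g x = h x := by
    intro x hx
    rw [← g⁻¹.injective.eq_iff, RelIso.inv_apply_self]
    exact hx.symm
  set M := {x | w x ≠ x} with hM
  have hMne : M.Nonempty := by
    by_contra! hemp
    apply hne
    ext x
    refine hgw x ?_
    by_contra hx
    exact (hemp ▸ (show x ∈ M from hx) : x ∈ (∅ : Set ℝ))
  have hMb : BddBelow M := ⟨0, fun x hx => by
    by_contra! hlt
    exact hx (hΓ.apply_eq_self w hwΓ x fun h => h.1.not_gt hlt)⟩
  have hlt : ∀ x < sInf M, w x = x := fun x hx => by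
    by_contra hne
    exact hx.not_ge (csInf_le hMb hne)
  have hc : w (sInf M) = sInf M := by
    by_contra hne
    obtain ⟨a, b, ho, hab⟩ := hΓ.exists_isOrbital hwΓ hne
    obtain ⟨x, hx⟩ := exists_between hab.1
    exact ho.ne x ⟨hx.1, hx.2.trans hab.2⟩ (hlt x hx.2)
  have hle : ∀ x ≤ sInf M, w x = x := fun x hx => hx.eq_or_lt.elim (fun e => e ▸ hc) (hlt x)
  have hgerm : w ∉ germFixer (𝓝[>] (sInf M)) := by
    intro hmem
    obtain ⟨y, hy, hsub⟩ := mem_nhdsGT_iff_exists_Ioo_subset.1 (mem_germFixer.1 hmem)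
    obtain ⟨x, hx, hxy⟩ := exists_lt_of_csInf_lt hMne hy
    rcases le_or_gt x (sInf M) with h | h
    · exact hx (hle x h)
    · exact hx (hsub ⟨h, hxy⟩)
  generalize sInf M = c at hle hgerm hc
  refine ⟨c, ⟨w, hwΓ, hΓ.exists_isOrbital_left hwΓ hc hgerm⟩, fun x hx => hgw x (hle x hx),
    hgerm, ?_⟩
  by_contra! hsmooth
  obtain ⟨a, b, hab⟩ := not_not.1 hsmooth.1
  obtain ⟨a', b', hab'⟩ := not_not.1 hsmooth.2
  -- Both functions are affine around `c` and agree on the left of `c`.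
  have hleft : ∀ᶠ z in 𝓝[<] c, a * z + b = a' * z + b' := by
    filter_upwards [hab.filter_mono nhdsWithin_le_nhds, hab'.filter_mono nhdsWithin_le_nhds,
      self_mem_nhdsWithin] with z h1 h2 (h3 : z < c)
    rw [← h1, ← h2, hgw z (hle z h3.le)]
  have hcc : a * c + b = a' * c + b' := by
    rw [← hab.self_of_nhds, ← hab'.self_of_nhds, hgw c hc]
  obtain ⟨z, hz, hzc : z < c⟩ := (hleft.and self_mem_nhdsWithin).exists
  have haa : a = a' := by
    have h1 : (a - a') * (z - c) = 0 := by linear_combination hz - hcc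
    rcases mul_eq_zero.1 h1 with h | h <;> linarith
  have hbb : b = b' := by rw [haa] at hcc; linarith
  refine hgerm ?_
  rw [mem_germFixer]
  filter_upwards [hab.filter_mono nhdsWithin_le_nhds, hab'.filter_mono nhdsWithin_le_nhds]
    with z h1 h2
  rw [hw, RelIso.mul_apply, h2, ← haa, ← hbb, ← h1, RelIso.inv_apply_self]

/-- A family of elements whose pairwise first differences lie in a finite set is countable: among
the elements agreeing up to the least point `a` of this set, there are only countably many germs
at `a`. -/
theorem countable_of_first_differences (F : Finset ℝ) : ∀ S : Set (ℝ ≃o ℝ), (∀ g ∈ S, g ∈ Γ) →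
    (∀ g ∈ S, ∀ h ∈ S, g ≠ h → ∃ c ∈ F, (∀ x ≤ c, g x = h x) ∧
      g⁻¹ * h ∉ germFixer (𝓝[>] c)) → S.Countable := by
  induction F using Finset.induction_on_min with
  | empty =>
    intro S _ hS
    refine Set.Subsingleton.countable fun g hg h hh => ?_
    by_contra hne
    obtain ⟨c, hc, -⟩ := hS g hg h hh hne
    simp at hc
  | insert a F haF ih =>
    intro S hSΓ hS
    rcases S.eq_empty_or_nonempty with rfl | ⟨g₀, hg₀⟩
    · simp
    have hagree : ∀ g ∈ S, g₀ a = g a := by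
      intro g hg
      by_cases hne : g₀ = g
      · rw [hne]
      obtain ⟨c, hc, hle, -⟩ := hS g₀ hg₀ g hg hne
      rcases Finset.mem_insert.1 hc with rfl | hc
      · exact hle _ le_rfl
      · exact hle a (haF c hc).le
    refine ((hΓ.countable_right_slopes a).biUnion (t := fun s _ =>
      {g | g ∈ S ∧ ∀ᶠ z in 𝓝[>] a, (g₀⁻¹ * g) z = a + s * (z - a)}) ?_).mono ?_
    · intro s _
      refine ih _ (fun g hg => hSΓ g hg.1) fun g hg h hh hne => ?_
      obtain ⟨c, hc, hle, hgerm⟩ := hS g hg.1 h hh.1 hne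
      rcases Finset.mem_insert.1 hc with rfl | hc
      · refine absurd ?_ hgerm
        rw [mem_germFixer]
        filter_upwards [hg.2, hh.2] with z h1 h2
        have h3 : g z = h z := g₀⁻¹.injective (h1.trans h2.symm)
        rw [RelIso.mul_apply, ← h3, RelIso.inv_apply_self]
      · exact ⟨c, hc, hle, hgerm⟩
    · intro g hg
      have hmem : g₀⁻¹ * g ∈ Γ := Γ.mul_mem (Γ.inv_mem (hSΓ g₀ hg₀)) (hSΓ g hg)
      have hfix : (g₀⁻¹ * g) a = a := by
        rw [RelIso.mul_apply, ← hagree g hg, RelIso.inv_apply_self]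
      obtain ⟨s, hs⟩ := (hΓ.isPLFun _ hmem).eventually_right a
      rw [hfix] at hs
      exact mem_iUnion₂.2 ⟨s, ⟨_, hmem, hfix, hs⟩, hg, hs⟩

theorem countable : (Γ : Set (ℝ ≃o ℝ)).Countable := by
  set E := {a : ℝ | ∃ g ∈ Γ, ∃ b, IsOrbital g a b}
  have hE : E.Countable := hΓ.countable_left_ends
  refine ((Set.countable_ofPred_finite_subset hE).biUnion (t := fun F _ =>
    {g | g ∈ Γ ∧ breakpoints g ∩ E = F}) ?_).mono ?_
  · rintro F ⟨hF, -⟩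
    refine hΓ.countable_of_first_differences hF.toFinset _ (fun g hg => hg.1)
      fun g hg h hh hne => ?_
    obtain ⟨c, hcE, hle, hgerm, hbr⟩ := hΓ.exists_first_difference hg.1 hh.1 hne
    refine ⟨c, hF.mem_toFinset.2 ?_, hle, hgerm⟩
    rcases hbr with hbr | hbr
    · rw [← hg.2]; exact ⟨hbr, hcE⟩
    · rw [← hh.2]; exact ⟨hbr, hcE⟩
  · intro g hg
    exact mem_iUnion₂.2 ⟨breakpoints g ∩ E,
      ⟨(hΓ.isPLFun g hg).finite_breakpoints.subset inter_subset_left, inter_subset_right⟩, hg, rfl⟩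

end IsLaminarPLGroup

/-! ### Extending homeomorphisms of the unit interval to the line -/

open Classical in
/-- The extension of a self-map of the unit interval by the identity. -/
noncomputable def extendToLine (f : unitInterval → unitInterval) (x : ℝ) : ℝ :=
  if h : x ∈ Icc (0 : ℝ) 1 then f ⟨x, h⟩ else x

theorem extendToLine_of_mem (f : unitInterval → unitInterval) {x : ℝ} (h : x ∈ Icc (0 : ℝ) 1) :
    extendToLine f x = f ⟨x, h⟩ := dif_pos h

theorem extendToLine_of_notMem (f : unitInterval → unitInterval) {x : ℝ}
    (h : x ∉ Icc (0 : ℝ) 1) : extendToLine f x = x := dif_neg h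

theorem extendToLine_comp (f g : unitInterval → unitInterval) (x : ℝ) :
    extendToLine f (extendToLine g x) = extendToLine (f ∘ g) x := by
  by_cases h : x ∈ Icc (0 : ℝ) 1
  · rw [extendToLine_of_mem _ h, extendToLine_of_mem _ h, extendToLine_of_mem _ (g ⟨x, h⟩).2]
    rfl
  · rw [extendToLine_of_notMem _ h, extendToLine_of_notMem _ h, extendToLine_of_notMem _ h]

theorem extendToLine_id (x : ℝ) : extendToLine id x = x := by
  by_cases h : x ∈ Icc (0 : ℝ) 1
  · rw [extendToLine_of_mem _ h]; rfl
  · rw [extendToLine_of_notMem _ h]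

theorem strictMono_extendToLine {f : unitInterval → unitInterval} (hf : StrictMono f) :
    StrictMono (extendToLine f) := by
  intro x y hxy
  by_cases hx : x ∈ Icc (0 : ℝ) 1 <;> by_cases hy : y ∈ Icc (0 : ℝ) 1
  · rw [extendToLine_of_mem _ hx, extendToLine_of_mem _ hy]
    exact hf hxy
  · rw [extendToLine_of_mem _ hx, extendToLine_of_notMem _ hy]
    have h1 : 1 < y := by
      by_contra! h
      exact hy ⟨hx.1.trans hxy.le, h⟩
    exact (f ⟨x, hx⟩).2.2.trans_lt h1
  · rw [extendToLine_of_notMem _ hx, extendToLine_of_mem _ hy]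
    have h1 : x < 0 := by
      by_contra! h
      exact hx ⟨h, hxy.le.trans hy.2⟩
    exact h1.trans_le (f ⟨y, hy⟩).2.1
  · rwa [extendToLine_of_notMem _ hx, extendToLine_of_notMem _ hy]

theorem isPLFun_extendToLine {f : unitInterval → unitInterval} (hf : IsPiecewiseLinear f)
    (hout : ∀ x ∉ Ioo (0 : ℝ) 1, extendToLine f x = x) : IsPLFun (extendToLine f) := by
  obtain ⟨B, hB, h⟩ := hf
  refine ⟨(Subtype.val '' B) ∪ {0, 1}, (hB.image _).union (by simp), fun x y hxy => ?_⟩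
  rw [Set.disjoint_union_right] at hxy
  obtain ⟨hxy, h01⟩ := hxy
  rcases le_or_gt y x with hyx | hlt
  · exact ⟨0, extendToLine f x, fun z hz => by
      rw [le_antisymm (hz.2.trans hyx) hz.1]; ring⟩
  by_cases houter : y ≤ 0 ∨ 1 ≤ x
  · refine ⟨1, 0, fun z hz => ?_⟩
    rw [hout z fun hz' => ?_]
    · ring
    · rcases houter with h1 | h1
      · exact (hz'.1.trans_le hz.2).not_ge h1
      · exact (hz.1.trans_lt hz'.2).not_ge h1
  push Not at houter
  have hx0 : 0 ≤ x := by
    by_contra! hneg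
    exact Set.disjoint_left.1 h01 (show (0 : ℝ) ∈ Ioo x y from ⟨hneg, houter.1⟩) (by simp)
  have hy1 : y ≤ 1 := by
    by_contra! hgt
    exact Set.disjoint_left.1 h01 (show (1 : ℝ) ∈ Ioo x y from ⟨houter.2, hgt⟩) (by simp)
  obtain ⟨a, b, hab⟩ := h ⟨x, hx0, houter.2.le⟩ ⟨y, houter.1.le, hy1⟩ (by
    rw [Set.disjoint_left]
    exact fun z hz hzB => Set.disjoint_left.1 hxy (show (z : ℝ) ∈ Ioo x y from hz) ⟨z, hzB, rfl⟩)
  refine ⟨a, b, fun z hz => ?_⟩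
  have hz01 : z ∈ Icc (0 : ℝ) 1 := ⟨hx0.trans hz.1, hz.2.trans hy1⟩
  rw [extendToLine_of_mem _ hz01]
  exact hab ⟨z, hz01⟩ hz

/-- The action of `PL_o(I)` on the line, trivial outside `I`. -/
noncomputable def lineAction : PLo →* (ℝ ≃o ℝ) where
  toFun f := (strictMono_extendToLine f.2.1).orderIsoOfRightInverse _
    (extendToLine (f⁻¹ : PLo).1) fun x => by
      rw [extendToLine_comp]
      convert extendToLine_id x
      funext t
      exact f.1.apply_symm_apply t
  map_one' := by
    ext x
    exact extendToLine_id x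
  map_mul' f g := by
    ext x
    exact (extendToLine_comp f.1 g.1 x).symm

theorem lineAction_apply (f : PLo) (x : ℝ) : lineAction f x = extendToLine f.1 x := rfl

theorem lineAction_injective : Function.Injective lineAction := by
  intro f g hfg
  ext x
  have h1 := congrArg (fun e : ℝ ≃o ℝ => e x) hfg
  simp only [lineAction_apply, extendToLine_of_mem _ x.2] at h1
  exact h1

theorem lineAction_apply_of_notMem (f : PLo) {x : ℝ} (hx : x ∉ Ioo (0 : ℝ) 1) :
    lineAction f x = x := by
  by_cases h : x ∈ Icc (0 : ℝ) 1
  · have h01 : x = 0 ∨ x = 1 := by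
      by_contra! hne
      exact hx ⟨lt_of_le_of_ne h.1 hne.1.symm, lt_of_le_of_ne h.2 hne.2⟩
    rw [lineAction_apply, extendToLine_of_mem _ h]
    rcases h01 with rfl | rfl
    · have h1 : f.1 ⟨0, h⟩ ≤ f.1 (f.1.symm 0) := f.2.1.monotone (f.1.symm 0).2.1
      rw [Homeomorph.apply_symm_apply] at h1
      exact le_antisymm h1 (f.1 _).2.1
    · have h1 : f.1 (f.1.symm 1) ≤ f.1 ⟨1, h⟩ := f.2.1.monotone (f.1.symm 1).2.2
      rw [Homeomorph.apply_symm_apply] at h1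
      exact le_antisymm (f.1 _).2.2 h1
  · rw [lineAction_apply, extendToLine_of_notMem _ h]

theorem isPLFun_lineAction (f : PLo) : IsPLFun (lineAction f) :=
  isPLFun_extendToLine f.2.2 fun _ => lineAction_apply_of_notMem f

theorem isLaminarPLGroup_map_lineAction {G : Subgroup PLo} (hG : IsLocallySolvable G) :
    IsLaminarPLGroup (G.map lineAction) where
  isPLFun := by
    rintro _ ⟨f, _, rfl⟩
    exact isPLFun_lineAction f
  apply_eq_self := by
    rintro _ ⟨f, _, rfl⟩ x hx
    exact lineAction_apply_of_notMem f hx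
  not_transition := by
    rintro _ ⟨f, hf, rfl⟩ _ ⟨g, hg, rfl⟩ a b c d hfo hgo hac hcb hbd
    set k : Set G := {⟨f, hf⟩, ⟨g, hg⟩}
    have hsolv : Group.IsSolvable (Subgroup.closure k) :=
      hG _ ((Subgroup.fg_iff _).2 ⟨k, rfl, Set.toFinite k⟩)
    have hfk : (⟨f, hf⟩ : G) ∈ k := Or.inl rfl
    have hgk : (⟨g, hg⟩ : G) ∈ k := Or.inr rfl
    refine not_isSolvable_of_transition
      (lineAction.comp (G.subtype.comp (Subgroup.closure k).subtype))
      (fun q => isPLFun_lineAction q.1.1)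
      (fun q x hx => lineAction_apply_of_notMem q.1.1 hx)
      (f := ⟨⟨f, hf⟩, Subgroup.subset_closure hfk⟩) (g := ⟨⟨g, hg⟩, Subgroup.subset_closure hgk⟩)
      ?_ hfo hgo hac hcb hbd hsolv
    rw [← Subgroup.closure_closure_coe_preimage (k := k)]
    congr 1
    ext q
    exact or_congr Subtype.ext_iff Subtype.ext_iff

/-- Every locally solvable subgroup of `PL_o(I)` is countable. -/
theorem mainTheorem4 (G : Subgroup PLo) (hG : IsLocallySolvable G) : Countable G := by
  have h := (isLaminarPLGroup_map_lineAction hG).countable.to_subtype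
  refine Function.Injective.countable
    (f := fun g : G => (⟨lineAction g, ⟨g, g.2, rfl⟩⟩ : (G.map lineAction : Set (ℝ ≃o ℝ)))) ?_
  intro g g' hgg'
  exact Subtype.ext (lineAction_injective (Subtype.ext_iff.1 hgg'))
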